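/- Let $0<\lambda<1$. For $0<l<1$ and $a>0$ consider the hybrid Lozi–Hénon map $f:\mathbb{R}^2\to\mathbb{R}^2$, $$f(x,y)=\bigl(x+y+g(x),\ \lambda(y+g(x))\bigr),\qquad g(x)=1-al|x|-(1+\lambda)x-a(1-l)x^2 .$$ Let $O_1=(x_1^s,0)$ be its fixed point in $x<0$, with $$x_1^s=\frac{1}{2a(1-l)}\Bigl[-1-\lambda+al-\sqrt{(al-(1+\lambda))^2+4a(1-l)}\Bigr].$$ When $al>1+\lambda$, the initial piece of the unstable separatrix of the saddle $O_1$ (the points having a backward orbit that stays in $x\le 0$ and converges to $O_1$) meets the line $x=0$ in exactly one point $M_1=(0,y_1)$; let $(x_3,y_3)=f^2(M_1)$. There exists $l^*=l^*(\lambda)\in(0,1)$ such that for every $l$ with $l^*<l<1$ the following holds. If $$al>1+\lambda\qquad\text{and}\qquad -y_3\le(1-\lambda)(x_3-x_1^s),$$ then $f$ has a strange hyperbolic attractor; moreover, for every such $l$ there are values of $a$ that satisfy both conditions. Here "$f$ has a strange hyperbolic attractor" means: there is a nonempty bounded connected open set $G\subset\mathbb{R}^2$ with $f(\overline{G})\subset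 G$ such that (i) $f$ is hyperbolic on $G\setminus\{x=0\}$: it is smooth there with invertible differential, and there are two disjoint open cones (double sectors) $K^u,K^s\subset\mathbb{R}^2$, the same at all points, and constants $\mu>1$, $0<\nu<1$, such that at every point of $G\setminus\{x=0\}$ one has $Df\,K^u\subset K^u$, $Df^{-1}K^s\subset K^s$, $|Df\,u|^2\ge\mu|u|^2$ for $u\in K^u$, and $|Df\,u|^2\le\nu|u|^2$ whenever $Df\,u\in K^s$ (Euclidean norm); (ii) the attractor $\mathcal{A}=\bigcap_{k\ge1}f^k(G)$ has sensitive dependence on initial conditions: there is $r>0$ such that for each $p\in\mathcal{A}$ and $\varepsilon>0$ there are $q\in\mathbb{R}^2$ with $\operatorname{dist}(p,q)<\varepsilon$ and $n\ge0$ with $\operatorname{dist}(f^n(p),f^n(q))\ge r$. -/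

import Mathlib

noncomputable section

namespace LoziHenon

/-! ### Hyperbolicity through constant invariant cones -/

/-- The open double sector spanned by `v` and `w`: all vectors `α v + β w` with `α`, `β` nonzero
and of the same sign. -/
def doubleSector (v w : ℝ × ℝ) : Set (ℝ × ℝ) :=
  {u | ∃ α β : ℝ, 0 < α * β ∧ u = α • v + β • w}

/-- A (nondegenerate, open) cone in the plane of tangent vectors. -/
def IsCone (K : Set (ℝ × ℝ)) : Prop :=
  ∃ v w : ℝ × ℝ, v.1 * w.2 - v.2 * w.1 ≠ 0 ∧ K = doubleSector v w

/-- The square of the Euclidean length of a tangent vector. -/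
def lenSq (u : ℝ × ℝ) : ℝ := u.1 ^ 2 + u.2 ^ 2

/-- `F` is smooth at every point of `S`, with invertible differential, and there are two disjoint
cones `Ku` (unstable) and `Ks` (stable), one and the same at all points of `S`, such that at each
point of `S` one has `DF Ku ⊆ Ku` and `DF⁻¹ Ks ⊆ Ks`, the differential `DF` expands the vectors of
`Ku`, and `DF` contracts the vectors that it sends into `Ks` (that is, `DF⁻¹` expands the vectors of
`Ks`). The expansion and contraction rates are uniform on `S`. -/
def IsConeHyperbolicOn (F : ℝ × ℝ → ℝ × ℝ) (S : Set (ℝ × ℝ)) : Prop :=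
  ∃ Ku Ks : Set (ℝ × ℝ), IsCone Ku ∧ IsCone Ks ∧ Disjoint Ku Ks ∧
    ∃ μ ν : ℝ, 1 < μ ∧ 0 < ν ∧ ν < 1 ∧
      ∀ p ∈ S, ContDiffAt ℝ ((⊤ : ℕ∞) : WithTop ℕ∞) F p ∧
        Function.Bijective (fderiv ℝ F p) ∧
        (∀ u ∈ Ku, fderiv ℝ F p u ∈ Ku ∧ μ * lenSq u ≤ lenSq (fderiv ℝ F p u)) ∧
        (∀ u, fderiv ℝ F p u ∈ Ks → u ∈ Ks ∧ lenSq (fderiv ℝ F p u) ≤ ν * lenSq u)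

/-! ### Attractors -/

/-- A trapping domain: a nonempty bounded connected open set whose closure is mapped into it. -/
def IsTrappingDomain (F : ℝ × ℝ → ℝ × ℝ) (G : Set (ℝ × ℝ)) : Prop :=
  IsOpen G ∧ IsConnected G ∧ Bornology.IsBounded G ∧ F '' closure G ⊆ G

/-- The attractor `⋂_{k ≥ 1} F^k(G)` of a trapping domain `G`. -/
def attractorOf (F : ℝ × ℝ → ℝ × ℝ) (G : Set (ℝ × ℝ)) : Set (ℝ × ℝ) :=
  ⋂ k : ℕ, F^[k + 1] '' G

/-- Sensitive dependence on initial conditions at the points of `A`. -/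
def IsSensitiveOn (F : ℝ × ℝ → ℝ × ℝ) (A : Set (ℝ × ℝ)) : Prop :=
  ∃ r : ℝ, 0 < r ∧ ∀ p ∈ A, ∀ ε : ℝ, 0 < ε →
    ∃ q : ℝ × ℝ, dist p q < ε ∧ ∃ n : ℕ, r ≤ dist (F^[n] p) (F^[n] q)

/-- `F`, which may fail to be smooth on the singular set `Sing`, has a strange hyperbolic
attractor: there is a trapping domain `G` such that `F` is hyperbolic on `G` off the singular set,
and the attractor of `G` has sensitive dependence on initial conditions. -/
def HasStrangeHyperbolicAttractor (F : ℝ × ℝ → ℝ × ℝ) (Sing : Set (ℝ × ℝ)) : Prop :=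
  ∃ G : Set (ℝ × ℝ), IsTrappingDomain F G ∧ IsConeHyperbolicOn F (G \ Sing) ∧
    IsSensitiveOn F (attractorOf F G)

/-! ### The hybrid Lozi–Hénon map -/

/-- The nonlinearity `g(x) = 1 - a l |x| - (1 + λ) x - a (1 - l) x²`. -/
def hybridG (lam l a x : ℝ) : ℝ :=
  1 - a * l * |x| - (1 + lam) * x - a * (1 - l) * x ^ 2

/-- The hybrid map `(x, y) ↦ (x + y + g(x), λ (y + g(x)))`. -/
def hybridMap (lam l a : ℝ) (p : ℝ × ℝ) : ℝ × ℝ :=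
  (p.1 + p.2 + hybridG lam l a p.1, lam * (p.2 + hybridG lam l a p.1))

/-- The line `x = 0` on which the map is not smooth. -/
def singularLine : Set (ℝ × ℝ) := {p | p.1 = 0}

/-- The abscissa `x₁ˢ` of the saddle fixed point `O₁ = (x₁ˢ, 0)` in the half-plane `x < 0`. -/
def saddleX (lam l a : ℝ) : ℝ :=
  (-1 - lam + (a * l - √((a * l - (1 + lam)) ^ 2 + 4 * a * (1 - l)))) / (2 * a * (1 - l))

/-- The initial piece, in the closed half-plane `x ≤ 0`, of the unstable separatrix of `O₁`: the
points that have a backward orbit which stays in `x ≤ 0` and converges to `O₁`. -/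
def initialSeparatrix (lam l a : ℝ) : Set (ℝ × ℝ) :=
  {p | ∃ q : ℕ → ℝ × ℝ, q 0 = p ∧ (∀ n, hybridMap lam l a (q (n + 1)) = q n) ∧
    (∀ n, (q n).1 ≤ 0) ∧
    Filter.Tendsto q Filter.atTop (nhds (saddleX lam l a, 0))}

/-- The unstable separatrix of `O₁` first crosses the line `x = 0` in the point `(0, y₁)`. -/
def IsCrossing (lam l a y₁ : ℝ) : Prop := (0, y₁) ∈ initialSeparatrix lam l a

/-- The inequality `-y₃ ≤ (1 - λ) (x₃ - x₁ˢ)`, where `(x₃, y₃)` is the second iterate of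
`(0, y₁)`. -/
def TrappingInequality (lam l a y₁ : ℝ) : Prop :=
  -((hybridMap lam l a)^[2] (0, y₁)).2 ≤
    (1 - lam) * (((hybridMap lam l a)^[2] (0, y₁)).1 - saddleX lam l a)

end LoziHenon

end

open Filter Topology Set

namespace LoziHenon

/-! Put `b = a l`, `c = a (1 - l)`. On either side of `x = 0` every difference quotient of the map,
and every differential, is a matrix `lin lam T` of determinant `λ` with `T ≥ b` on the left and `T ≤
-b` on the right. Since `b > 1 + λ`, fixed cones are invariant under all of them, not only for
tangent vectors but also for chords (`formU_lin`, `formS_lin`). This gives hyperbolicity off the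
line.

Sensitivity is a contest between expansion and cutting. A horizontal segment at a point of the
attractor is an unstable arc; as long as it is not cut by `x = 0`, its extent grows by `b - λ > 1`
per step. The cuts are few: near any point, the `i`-th preimage of the line lies in two stable
pieces, whatever `i` is (`exists_nhds_simpleAt_crossing`), and an unstable arc meets a stable piece
at most once. So `N` steps make at most `2N` cuts, which `(b - λ)^N` outweighs, and a subarc doubles
(`UnstableArc.exists_doubling`). The images of the segment therefore cannot all stay near the orbit.

For the trapping domain the separatrix is needed. Backward orbits on the left solve a second order
recurrence, in which replacing `-u²` by `u |u|` makes the nonlinearity increasing with slope at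
least `b` on all of `ℝ`. Bounded solutions then come from a contraction, and the separatrix is the
graph of `x ↦ λ (x - ξ x)` with `ξ` monotone and 1-Lipschitz (`exists_isPreimageMap`,
`crossing_iff`). Pushing this graph up slightly bounds the domain from above; the trapping
inequality keeps the image of the far right corner away from the stable side of the saddle.

Parameters exist because for `c` and `b - 1 - λ` small the saddle is far to the left, while `(x₃,
y₃)` stays bounded (`trappingInequality_of_large_saddle`). -/

/-! ### The map in the parameters `b = a l`, `c = a (1 - l)` -/

/-- The nonlinearity `1 - b |x| - (1 + λ) x - c x²`. -/
def pieceG (lam b c x : ℝ) : ℝ := 1 - b * |x| - (1 + lam) * x - c * x ^ 2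

/-- The map `(x, y) ↦ (x + y + g(x), λ (y + g(x)))`. -/
def pieceMap (lam b c : ℝ) (p : ℝ × ℝ) : ℝ × ℝ :=
  (p.1 + p.2 + pieceG lam b c p.1, lam * (p.2 + pieceG lam b c p.1))

theorem hybridMap_eq_pieceMap (lam l a : ℝ) :
    hybridMap lam l a = pieceMap lam (a * l) (a * (1 - l)) := rfl

theorem continuous_pieceMap (lam b c : ℝ) : Continuous (pieceMap lam b c) := by
  unfold pieceMap pieceG
  fun_prop

/-- The matrix of trace `T` and determinant `λ` that the differentials of the map and its
difference quotients have. -/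
def lin (lam T : ℝ) (u : ℝ × ℝ) : ℝ × ℝ :=
  ((T - lam) * u.1 + u.2, lam * ((T - 1 - lam) * u.1 + u.2))

theorem lin_snd (lam T : ℝ) (u : ℝ × ℝ) : (lin lam T u).2 = lam * ((lin lam T u).1 - u.1) := by
  simp only [lin]; ring

theorem secant_nonpos {lam b c : ℝ} (hc : 0 ≤ c) {p q : ℝ × ℝ} (hp : p.1 ≤ 0) (hq : q.1 ≤ 0) :
    ∃ T, b ≤ T ∧ pieceMap lam b c q - pieceMap lam b c p = lin lam T (q - p) := by
  refine ⟨b - c * (p.1 + q.1), by nlinarith, ?_⟩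
  ext <;> simp only [pieceMap, pieceG, lin, Prod.fst_sub, Prod.snd_sub, abs_of_nonpos hp,
    abs_of_nonpos hq] <;> ring

theorem secant_nonneg {lam b c : ℝ} (hc : 0 ≤ c) {p q : ℝ × ℝ} (hp : 0 ≤ p.1) (hq : 0 ≤ q.1) :
    ∃ T, T ≤ -b ∧ pieceMap lam b c q - pieceMap lam b c p = lin lam T (q - p) := by
  refine ⟨-b - c * (p.1 + q.1), by nlinarith, ?_⟩
  ext <;> simp only [pieceMap, pieceG, lin, Prod.fst_sub, Prod.snd_sub, abs_of_nonneg hp,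
    abs_of_nonneg hq] <;> ring

/-! ### The cones -/

/-- The quadratic form that is positive on the unstable cone. -/
def formU (lam : ℝ) (u : ℝ × ℝ) : ℝ := u.2 * (2 * lam * u.1 - u.2)

/-- The quadratic form that is positive on the stable cone. -/
def formS (lam : ℝ) (u : ℝ × ℝ) : ℝ := ((1 - lam) * u.1 + u.2) * (u.2 - (1 + lam) * u.1)

/-- An image vector with abscissa `X` has ordinate `λ (X - x)`. This turns both forms, on image
vectors, into differences of squares of abscissae: entering the unstable cone means `|X| > |x|`,
entering the stable one means `|X| < λ |x|`. -/
theorem formU_lin (lam T : ℝ) (u : ℝ × ℝ) :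
    formU lam (lin lam T u) = lam ^ 2 * ((lin lam T u).1 ^ 2 - u.1 ^ 2) := by
  simp only [formU, lin]; ring

theorem formS_lin (lam T : ℝ) (u : ℝ × ℝ) :
    formS lam (lin lam T u) = lam ^ 2 * u.1 ^ 2 - (lin lam T u).1 ^ 2 := by
  simp only [formS, lin]; ring

theorem formU_neg (lam : ℝ) (u : ℝ × ℝ) : formU lam (-u) = formU lam u := by
  simp only [formU, Prod.fst_neg, Prod.snd_neg]; ring

theorem formS_neg (lam : ℝ) (u : ℝ × ℝ) : formS lam (-u) = formS lam u := by
  simp only [formS, Prod.fst_neg, Prod.snd_neg]; ring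

theorem lin_neg (lam T : ℝ) (u : ℝ × ℝ) : lin lam T (-u) = -lin lam T u := by
  ext <;> simp only [lin, Prod.fst_neg, Prod.snd_neg] <;> ring

theorem snd_mem_of_formU_nonneg {lam : ℝ} (hlam : 0 < lam) {u : ℝ × ℝ} (hu : 0 ≤ formU lam u)
    (h1 : 0 ≤ u.1) : 0 ≤ u.2 ∧ u.2 ≤ 2 * lam * u.1 := by
  unfold formU at hu
  have h2 : 0 ≤ 2 * lam * u.1 := by positivity
  constructor <;> by_contra! h <;> nlinarith

/-- The closed cones are transversal: slopes in the unstable one lie in `[0, 2λ]`, those in the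
stable one avoid the open interval from `-(1 - λ)` to `1 + λ`, and `2λ < 1 + λ`. -/
theorem eq_zero_of_formU_formS_nonneg {lam : ℝ} (h0 : 0 < lam) (h1 : lam < 1) {u : ℝ × ℝ}
    (hU : 0 ≤ formU lam u) (hS : 0 ≤ formS lam u) : u = 0 := by
  have key : ∀ v : ℝ × ℝ, 0 ≤ formU lam v → 0 ≤ formS lam v → 0 ≤ v.1 → v = 0 := by
    intro v hU hS hv
    obtain ⟨h2, h3⟩ := snd_mem_of_formU_nonneg h0 hU hv
    have hv1 : v.1 = 0 := by
      by_contra hne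
      have hpos : 0 < v.1 := lt_of_le_of_ne hv (Ne.symm hne)
      have ha : 0 < (1 - lam) * v.1 + v.2 := by nlinarith
      have hb : v.2 - (1 + lam) * v.1 < 0 := by nlinarith
      have := mul_neg_of_pos_of_neg ha hb
      unfold formS at hS
      linarith
    rw [hv1] at h3
    exact Prod.ext hv1 (by simp only [Prod.snd_zero]; linarith)
  rcases le_total 0 u.1 with h | h
  · exact key u hU hS h
  · have := key (-u) (by rwa [formU_neg]) (by rwa [formS_neg]) (by simpa using h)
    simpa using this

/-- Vectors of the closed unstable cone have their abscissae expanded. -/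
theorem expand_fst {lam b T : ℝ} (h0 : 0 < lam) (hT : b ≤ T ∨ T ≤ -b) {u : ℝ × ℝ}
    (hu : 0 ≤ formU lam u) : (b - lam) * |u.1| ≤ |(lin lam T u).1| := by
  have key : ∀ v : ℝ × ℝ, 0 ≤ formU lam v → 0 ≤ v.1 →
      (b - lam) * v.1 ≤ |(lin lam T v).1| := by
    intro v hU hv
    obtain ⟨h2, h3⟩ := snd_mem_of_formU_nonneg h0 hU hv
    simp only [lin]
    rcases hT with hT | hT
    · exact le_trans (by nlinarith) (le_abs_self _)
    · exact le_trans (by nlinarith) (neg_le_abs _)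
  rcases le_total 0 u.1 with h | h
  · rw [abs_of_nonneg h]; exact key u hu h
  · rw [abs_of_nonpos h]
    have := key (-u) (by rwa [formU_neg]) (by simpa using h)
    simpa [lin_neg] using this

theorem formU_lin_nonneg {lam b T : ℝ} (h0 : 0 < lam) (hb : 1 + lam < b) (hT : b ≤ T ∨ T ≤ -b)
    {u : ℝ × ℝ} (hu : 0 ≤ formU lam u) : 0 ≤ formU lam (lin lam T u) := by
  rw [formU_lin]
  have h := expand_fst h0 hT hu
  have h' : |u.1| ≤ |(lin lam T u).1| := by nlinarith [abs_nonneg u.1]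
  have := sq_le_sq.2 h'
  exact mul_nonneg (sq_nonneg _) (by linarith)

/-- The length of the vectors of the unstable cone is expanded. -/
theorem lenSq_expand {lam b T : ℝ} (h0 : 0 < lam) (h1 : lam < 1) (hb : 1 + lam < b)
    (hT : b ≤ T ∨ T ≤ -b) {u : ℝ × ℝ} (hu : 0 ≤ formU lam u) :
    (b - lam) * lenSq u ≤ lenSq (lin lam T u) := by
  have key : ∀ v : ℝ × ℝ, 0 ≤ formU lam v → 0 ≤ v.1 →
      (b - lam) * lenSq v ≤ lenSq (lin lam T v) := by
    intro v hU hv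
    obtain ⟨h2, h3⟩ := snd_mem_of_formU_nonneg h0 hU hv
    rw [lenSq, lenSq, lin_snd]
    obtain ⟨d, rfl⟩ : ∃ d, b = 1 + lam + d := ⟨b - 1 - lam, by ring⟩
    have hd : 0 < d := by linarith
    set X := (lin lam T v).1 with hX
    have hXe : X = (T - lam) * v.1 + v.2 := rfl
    rcases hT with hT | hT
    · have hX1 : (1 + d) * v.1 + v.2 ≤ X := by nlinarith
      have h5 : ((1 + d) * v.1 + v.2) ^ 2 ≤ X ^ 2 :=
        pow_le_pow_left₀ (by positivity) hX1 2
      have h6 : 0 ≤ d * v.2 * (2 * v.1 - v.2) := by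
        apply mul_nonneg (by positivity); nlinarith
      nlinarith [mul_nonneg h2 hv, sq_nonneg (lam * (X - v.1)), mul_nonneg hd.le (sq_nonneg v.1),
        mul_nonneg (mul_nonneg hd.le hd.le) (sq_nonneg v.1)]
    · have hX1 : (1 + d) * v.1 ≤ -X := by nlinarith
      have h5 : ((1 + d) * v.1) ^ 2 ≤ (-X) ^ 2 :=
        pow_le_pow_left₀ (by positivity) hX1 2
      -- The abscissa alone need not pay for `(1 + d) v₂²`. The ordinate of the image does: `v₂ ≤ 2λ
      -- v₁` and `4 (1 + d) ≤ (2 + d)²`.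
      have h6 : ((2 + d) * v.1) ^ 2 ≤ (v.1 - X) ^ 2 :=
        pow_le_pow_left₀ (by positivity) (by linarith) 2
      have h7 : v.2 ^ 2 ≤ (2 * lam * v.1) ^ 2 := pow_le_pow_left₀ h2 h3 2
      have h8 := mul_le_mul_of_nonneg_left h6 (sq_nonneg lam)
      have h9 := mul_le_mul_of_nonneg_left h7 (by positivity : 0 ≤ 1 + d)
      nlinarith [mul_nonneg hd.le (sq_nonneg v.1), mul_nonneg (sq_nonneg d) (sq_nonneg v.1),
        mul_nonneg (sq_nonneg d) (sq_nonneg (lam * v.1))]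
  rcases le_total 0 u.1 with h | h
  · exact key u hu h
  · have := key (-u) (by rwa [formU_neg]) (by simpa using h)
    simpa [lin_neg, lenSq] using this

/-- Where the image of `u` lies in the closed stable cone, so does `u`, and the vertical and
horizontal components of `u` and of its image are related in sign. -/
theorem formS_of_lin_nonneg {lam b T : ℝ} (h0 : 0 < lam) (hb : 1 + lam < b)
    (hT : b ≤ T ∨ T ≤ -b) {u : ℝ × ℝ} (hu : 0 ≤ formS lam (lin lam T u)) :
    |(lin lam T u).1| ≤ lam * |u.1| ∧ 0 ≤ formS lam u := by
  rw [formS_lin] at hu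
  have hX : |(lin lam T u).1| ≤ lam * |u.1| := by
    have : (lin lam T u).1 ^ 2 ≤ (lam * |u.1|) ^ 2 := by rw [mul_pow, sq_abs]; linarith
    exact abs_le_of_sq_le_sq this (by positivity)
  refine ⟨hX, ?_⟩
  set X := (lin lam T u).1 with hXd
  have hXe : X = (T - lam) * u.1 + u.2 := rfl
  -- `|X| ≤ λ |x|`, while `T - 1` and `T + 1` have the same sign and modulus above `λ`; hence both
  -- factors have the same sign.
  have e : formS lam u = (X - (T - 1) * u.1) * (X - (T + 1) * u.1) := by
    rw [formS, hXe]; ring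
  rw [e]
  obtain ⟨hX1, hX2⟩ := abs_le.1 hX
  rcases le_total 0 u.1 with h | h <;> [rw [abs_of_nonneg h] at *; rw [abs_of_nonpos h] at *] <;>
    rcases hT with hT | hT
  · exact mul_nonneg_of_nonpos_of_nonpos (by nlinarith) (by nlinarith)
  · exact mul_nonneg (by nlinarith) (by nlinarith)
  · exact mul_nonneg (by nlinarith) (by nlinarith)
  · exact mul_nonneg_of_nonpos_of_nonpos (by nlinarith) (by nlinarith)

/-- The squared length of the image is `X² + λ² (X - x)²`; its terms are bounded by `λ² x²` and,
since `|X - x| ≤ |u₂|`, by `λ² u₂²`. -/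
theorem formS_of_lin_pos {lam b T : ℝ} (h0 : 0 < lam) (h1 : lam < 1) (hb : 1 + lam < b)
    (hT : b ≤ T ∨ T ≤ -b) {u : ℝ × ℝ} (hu : 0 < formS lam (lin lam T u)) :
    0 < formS lam u ∧ lenSq (lin lam T u) ≤ lam ^ 2 * lenSq u := by
  have hX := (formS_of_lin_nonneg h0 hb hT hu.le).1
  rw [formS_lin] at hu
  have hu1 : u.1 ≠ 0 := by
    rintro h; rw [h] at hu; nlinarith [sq_nonneg (lin lam T u).1]
  rw [lenSq, lenSq, lin_snd]
  set X := (lin lam T u).1 with hXd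
  have hXe : u.2 = X - (T - lam) * u.1 := by rw [hXd, lin]; ring
  have e : formS lam u = (X - (T - 1) * u.1) * (X - (T + 1) * u.1) := by
    rw [formS, hXe]; ring
  rw [e]
  have h2 : (X - u.1) ^ 2 ≤ u.2 ^ 2 ∧ 0 < (X - (T - 1) * u.1) * (X - (T + 1) * u.1) := by
    rw [sq_le_sq, hXe]
    obtain ⟨hX1, hX2⟩ := abs_le.1 hX
    rcases lt_or_gt_of_ne hu1 with h | h <;>
      [rw [abs_of_neg h] at *; rw [abs_of_pos h] at *] <;> rcases hT with hT | hT
    · refine ⟨?_, mul_pos (by nlinarith) (by nlinarith)⟩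
      rw [abs_of_nonneg (by nlinarith), abs_of_nonneg (by nlinarith)]; nlinarith
    · refine ⟨?_, mul_pos_of_neg_of_neg (by nlinarith) (by nlinarith)⟩
      rw [abs_of_nonneg (by nlinarith), abs_of_nonpos (by nlinarith)]; nlinarith
    · refine ⟨?_, mul_pos_of_neg_of_neg (by nlinarith) (by nlinarith)⟩
      rw [abs_of_nonpos (by nlinarith), abs_of_nonpos (by nlinarith)]; nlinarith
    · refine ⟨?_, mul_pos (by nlinarith) (by nlinarith)⟩
      rw [abs_of_nonpos (by nlinarith), abs_of_nonneg (by nlinarith)]; nlinarith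
  refine ⟨h2.2, ?_⟩
  nlinarith [mul_le_mul_of_nonneg_left h2.1 (sq_nonneg lam)]

/-- Cramer's rule: the two factors are the coordinates of `u` in the basis `v, w`, up to the common
determinant. -/
theorem mem_doubleSector_iff {v w u : ℝ × ℝ} (h : v.1 * w.2 - v.2 * w.1 ≠ 0) :
    u ∈ doubleSector v w ↔ 0 < (u.1 * w.2 - u.2 * w.1) * (v.1 * u.2 - v.2 * u.1) := by
  have hsq : 0 < (v.1 * w.2 - v.2 * w.1) ^ 2 := by positivity
  constructor
  · rintro ⟨α, β, hαβ, rfl⟩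
    have : ((α • v + β • w).1 * w.2 - (α • v + β • w).2 * w.1) *
        (v.1 * (α • v + β • w).2 - v.2 * (α • v + β • w).1) =
        α * β * (v.1 * w.2 - v.2 * w.1) ^ 2 := by
      simp only [Prod.fst_add, Prod.snd_add, Prod.smul_fst, Prod.smul_snd, smul_eq_mul]; ring
    rw [this]; positivity
  · intro hu
    refine ⟨(u.1 * w.2 - u.2 * w.1) / (v.1 * w.2 - v.2 * w.1),
      (v.1 * u.2 - v.2 * u.1) / (v.1 * w.2 - v.2 * w.1), ?_, ?_⟩
    · rw [div_mul_div_comm, ← sq]; positivity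
    · ext <;> simp only [Prod.fst_add, Prod.snd_add, Prod.smul_fst, Prod.smul_snd, smul_eq_mul] <;>
        rw [div_mul_eq_mul_div, div_mul_eq_mul_div, ← add_div, eq_div_iff h] <;> ring

theorem isCone_formU {lam : ℝ} (h0 : 0 < lam) :
    IsCone {u | 0 < formU lam u} := by
  refine ⟨(1, 0), (1, 2 * lam), by norm_num; exact h0.ne', ?_⟩
  ext u
  rw [mem_doubleSector_iff (by norm_num; exact h0.ne'), Set.mem_ofPred_eq, formU]
  simp only
  ring_nf

theorem isCone_formS (lam : ℝ) : IsCone {u | 0 < formS lam u} := by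
  have h : ((1, 1 + lam) : ℝ × ℝ).1 * ((-1, 1 - lam) : ℝ × ℝ).2 -
      ((1, 1 + lam) : ℝ × ℝ).2 * ((-1, 1 - lam) : ℝ × ℝ).1 ≠ 0 := by
    simp only; ring_nf; norm_num
  refine ⟨(1, 1 + lam), (-1, 1 - lam), h, ?_⟩
  ext u
  rw [mem_doubleSector_iff h, Set.mem_ofPred_eq, formS]
  simp only
  ring_nf

/-! ### Hyperbolicity -/

/-- `lin` as a continuous linear map. -/
def linCLM (lam T : ℝ) : ℝ × ℝ →L[ℝ] ℝ × ℝ :=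
  ((T - lam) • ContinuousLinearMap.fst ℝ ℝ ℝ + ContinuousLinearMap.snd ℝ ℝ ℝ).prod
    (lam • ((T - 1 - lam) • ContinuousLinearMap.fst ℝ ℝ ℝ + ContinuousLinearMap.snd ℝ ℝ ℝ))

theorem linCLM_apply (lam T : ℝ) (u : ℝ × ℝ) : linCLM lam T u = lin lam T u := by
  simp [linCLM, lin, mul_add]

theorem lin_bijective {lam : ℝ} (h0 : 0 < lam) (T : ℝ) : Function.Bijective (lin lam T) := by
  rw [Function.bijective_iff_has_inverse]
  refine ⟨fun w => (w.1 - w.2 / lam, w.1 - (T - lam) * (w.1 - w.2 / lam)), fun u => ?_,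
    fun w => ?_⟩ <;> ext <;> simp only [lin] <;> field_simp <;> ring

theorem hasFDerivAt_pieceMap {lam b c : ℝ} (hc : 0 ≤ c) {p : ℝ × ℝ} (hp : p.1 ≠ 0) :
    ∃ T, (b ≤ T ∨ T ≤ -b) ∧ HasFDerivAt (pieceMap lam b c) (linCLM lam T) p := by
  -- Here `s = ∓1` is the derivative of `|x|`, so both half-planes are treated at once.
  have main : ∀ s : ℝ, HasDerivAt (fun x : ℝ => |x|) s p.1 →
      HasFDerivAt (pieceMap lam b c) (linCLM lam (-b * s - 2 * c * p.1)) p := by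
    intro s hs
    have hg : HasDerivAt (pieceG lam b c) (-b * s - (1 + lam) - 2 * c * p.1) p.1 := by
      have := (((hs.const_mul b).const_sub 1).sub ((hasDerivAt_id p.1).const_mul (1 + lam))).sub
        (((hasDerivAt_id p.1).pow 2).const_mul c)
      refine this.congr_deriv ?_
      simp only [id_eq]; norm_num; ring
    have h1 : HasFDerivAt (fun q : ℝ × ℝ => pieceG lam b c q.1)
        ((-b * s - (1 + lam) - 2 * c * p.1) • ContinuousLinearMap.fst ℝ ℝ ℝ) p :=
      hg.comp_hasFDerivAt p hasFDerivAt_fst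
    have h2 := ((hasFDerivAt_fst (𝕜 := ℝ) (p := p)).add
      (hasFDerivAt_snd (𝕜 := ℝ) (p := p))).add h1
    have h3 := ((hasFDerivAt_snd (𝕜 := ℝ) (p := p)).add h1).const_mul lam
    refine (h2.prodMk h3).congr_fderiv ?_
    ext <;> simp [linCLM] <;> first | ring1 | (left; ring1)
  rcases lt_or_gt_of_ne hp with h | h
  · exact ⟨_, Or.inl (by nlinarith), main (-1) (hasDerivAt_abs_neg h)⟩
  · exact ⟨_, Or.inr (by nlinarith), main 1 (hasDerivAt_abs_pos h)⟩

theorem contDiffAt_pieceMap {lam b c : ℝ} {p : ℝ × ℝ} (hp : p.1 ≠ 0) :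
    ContDiffAt ℝ ((⊤ : ℕ∞) : WithTop ℕ∞) (pieceMap lam b c) p := by
  have h1 : ContDiffAt ℝ ((⊤ : ℕ∞) : WithTop ℕ∞) (fun q : ℝ × ℝ => |q.1|) p :=
    contDiffAt_fst.abs hp
  have h2 : ContDiffAt ℝ ((⊤ : ℕ∞) : WithTop ℕ∞) (fun q : ℝ × ℝ => pieceG lam b c q.1) p := by
    unfold pieceG
    exact ((contDiffAt_const.sub (contDiffAt_const.mul h1)).sub
      (contDiffAt_const.mul contDiffAt_fst)).sub (contDiffAt_const.mul (contDiffAt_fst.pow 2))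
  exact ((contDiffAt_fst.add contDiffAt_snd).add h2).prodMk
    (contDiffAt_const.mul (contDiffAt_snd.add h2))

theorem isConeHyperbolicOn_pieceMap {lam b c : ℝ} (h0 : 0 < lam) (h1 : lam < 1)
    (hb : 1 + lam < b) (hc : 0 ≤ c) (G : Set (ℝ × ℝ)) :
    IsConeHyperbolicOn (pieceMap lam b c) (G \ singularLine) := by
  refine ⟨_, _, isCone_formU h0, isCone_formS lam, ?_, b - lam, lam ^ 2,
    by linarith, by positivity, by nlinarith, ?_⟩
  · rw [Set.disjoint_left]
    intro u hu hs
    have := eq_zero_of_formU_formS_nonneg h0 h1 (le_of_lt hu) (le_of_lt hs)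
    simp [this, formU] at hu
  · rintro p ⟨-, hp⟩
    have hp : p.1 ≠ 0 := hp
    obtain ⟨T, hT, hd⟩ := hasFDerivAt_pieceMap (lam := lam) (b := b) hc hp
    rw [hd.fderiv]
    have hfun : ⇑(linCLM lam T) = lin lam T := funext (linCLM_apply lam T)
    rw [hfun]
    refine ⟨contDiffAt_pieceMap hp, lin_bijective h0 T, fun u hu => ⟨?_, ?_⟩, fun u hu => ?_⟩
    · have hu : 0 < formU lam u := hu
      have hu1 : 0 < |u.1| := by
        rw [abs_pos]; rintro h; rw [formU, h] at hu; nlinarith [sq_nonneg u.2]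
      rw [Set.mem_ofPred_eq, formU_lin]
      have h := expand_fst h0 hT hu.le
      have h' : |u.1| < |(lin lam T u).1| := by nlinarith
      have := sq_lt_sq.2 h'
      exact mul_pos (by positivity) (by linarith)
    · exact lenSq_expand h0 h1 hb hT (le_of_lt hu)
    · exact formS_of_lin_pos h0 h1 hb hT hu

/-! ### Local structure of the preimages of the singular line -/

/-- A set all of whose chords lie in the closed stable cone. -/
def StableSet (lam : ℝ) (S : Set (ℝ × ℝ)) : Prop :=
  ∀ p ∈ S, ∀ q ∈ S, 0 ≤ formS lam (q - p)

/-- The points that are mapped to the singular line in `i` steps. -/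
def crossing (lam b c : ℝ) (i : ℕ) : Set (ℝ × ℝ) := {q | ((pieceMap lam b c)^[i] q).1 = 0}

/-- Either all chords of `C` are stable, or `C` consists of two such pieces, and seen from `z` lies
in one half of the closed stable cone. -/
def SimpleAt (lam : ℝ) (C : Set (ℝ × ℝ)) (z : ℝ × ℝ) : Prop :=
  StableSet lam C ∨ ∃ S₁ S₂, StableSet lam S₁ ∧ StableSet lam S₂ ∧ C ⊆ S₁ ∪ S₂ ∧
    (∀ q ∈ C, 0 ≤ formS lam (q - z)) ∧ ((∀ q ∈ C, 0 ≤ (q - z).2) ∨ (∀ q ∈ C, (q - z).2 ≤ 0))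

theorem StableSet.mono {lam : ℝ} {S S' : Set (ℝ × ℝ)} (h : StableSet lam S) (hs : S' ⊆ S) :
    StableSet lam S' := fun p hp q hq => h p (hs hp) q (hs hq)

theorem SimpleAt.exists_cover {lam : ℝ} {C : Set (ℝ × ℝ)} {z : ℝ × ℝ} (h : SimpleAt lam C z) :
    ∃ S₁ S₂, StableSet lam S₁ ∧ StableSet lam S₂ ∧ C ⊆ S₁ ∪ S₂ := by
  rcases h with h | ⟨S₁, S₂, h1, h2, h3, -⟩
  · exact ⟨C, C, h, h, by simp⟩
  · exact ⟨S₁, S₂, h1, h2, h3⟩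

theorem sign_of_stable {lam T : ℝ} (h0 : 0 < lam) (h1 : lam < 1) {u : ℝ × ℝ}
    (hX : |(lin lam T u).1| ≤ lam * |u.1|) :
    (0 ≤ (lin lam T u).2 → u.1 ≤ 0) ∧ ((lin lam T u).2 ≤ 0 → 0 ≤ u.1) := by
  rw [lin_snd]
  obtain ⟨hX1, hX2⟩ := abs_le.1 hX
  constructor <;> intro h <;> by_contra! hu
  · rw [abs_of_pos hu] at *
    have := nonneg_of_mul_nonneg_right h h0
    nlinarith
  · rw [abs_of_neg hu] at *
    have : (lin lam T u).1 - u.1 ≤ 0 := by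
      by_contra! h'
      have := mul_pos h0 h'
      linarith
    nlinarith

/-- On the left a pulled-back stable chord has coordinates of opposite sign, on the right of equal
sign, because `T - λ` dominates the term `|X| ≤ λ |x|`. Thus a stable piece through the image of a
point of `x = 0` folds into a V opening upwards. The last two clauses say that the sign of the image
ordinate determines the side on which the chord points. -/
theorem stable_pullback_nonpos {lam b c : ℝ} (h0 : 0 < lam) (h1 : lam < 1)
    (hb : 1 + lam < b) (hc : 0 ≤ c) {p q : ℝ × ℝ}
    (hp : p.1 ≤ 0) (hq : q.1 ≤ 0)
    (h : 0 ≤ formS lam (pieceMap lam b c q - pieceMap lam b c p)) :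
    0 ≤ formS lam (q - p) ∧ ((q - p).1 ≤ 0 → 0 ≤ (q - p).2) ∧ (0 ≤ (q - p).1 → (q - p).2 ≤ 0) ∧
    (0 ≤ (pieceMap lam b c q - pieceMap lam b c p).2 → (q - p).1 ≤ 0) ∧
    ((pieceMap lam b c q - pieceMap lam b c p).2 ≤ 0 → 0 ≤ (q - p).1) := by
  obtain ⟨T, hT, e⟩ := secant_nonpos (lam := lam) (b := b) hc hp hq
  rw [e] at h ⊢
  obtain ⟨hX, hS⟩ := formS_of_lin_nonneg h0 hb (Or.inl hT) h
  obtain ⟨s1, s2⟩ := sign_of_stable h0 h1 hX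
  set u := q - p
  obtain ⟨hX1, hX2⟩ := abs_le.1 hX
  have hXe : u.2 = (lin lam T u).1 - (T - lam) * u.1 := by simp [lin]
  refine ⟨hS, fun hu => ?_, fun hu => ?_, s1, s2⟩
  · rw [abs_of_nonpos hu] at *; nlinarith
  · rw [abs_of_nonneg hu] at *; nlinarith

theorem stable_pullback_nonneg {lam b c : ℝ} (h0 : 0 < lam) (h1 : lam < 1)
    (hb : 1 + lam < b) (hc : 0 ≤ c) {p q : ℝ × ℝ}
    (hp : 0 ≤ p.1) (hq : 0 ≤ q.1)
    (h : 0 ≤ formS lam (pieceMap lam b c q - pieceMap lam b c p)) :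
    0 ≤ formS lam (q - p) ∧ (0 ≤ (q - p).1 → 0 ≤ (q - p).2) ∧ ((q - p).1 ≤ 0 → (q - p).2 ≤ 0) ∧
    (0 ≤ (pieceMap lam b c q - pieceMap lam b c p).2 → (q - p).1 ≤ 0) ∧
    ((pieceMap lam b c q - pieceMap lam b c p).2 ≤ 0 → 0 ≤ (q - p).1) := by
  obtain ⟨T, hT, e⟩ := secant_nonneg (lam := lam) (b := b) hc hp hq
  rw [e] at h ⊢
  obtain ⟨hX, hS⟩ := formS_of_lin_nonneg h0 hb (Or.inr hT) h
  obtain ⟨s1, s2⟩ := sign_of_stable h0 h1 hX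
  set u := q - p
  obtain ⟨hX1, hX2⟩ := abs_le.1 hX
  have hXe : u.2 = (lin lam T u).1 - (T - lam) * u.1 := by simp [lin]
  refine ⟨hS, fun hu => ?_, fun hu => ?_, s1, s2⟩
  · rw [abs_of_nonneg hu] at *; nlinarith
  · rw [abs_of_nonpos hu] at *; nlinarith

theorem StableSet.preimage_nonpos {lam b c : ℝ} (h0 : 0 < lam) (h1 : lam < 1)
    (hb : 1 + lam < b) (hc : 0 ≤ c)
    {S : Set (ℝ × ℝ)} (hS : StableSet lam S) :
    StableSet lam (pieceMap lam b c ⁻¹' S ∩ {q | q.1 ≤ 0}) := fun _ hp _ hq =>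
  (stable_pullback_nonpos h0 h1 hb hc hp.2 hq.2 (hS _ hp.1 _ hq.1)).1

theorem StableSet.preimage_nonneg {lam b c : ℝ} (h0 : 0 < lam) (h1 : lam < 1)
    (hb : 1 + lam < b) (hc : 0 ≤ c)
    {S : Set (ℝ × ℝ)} (hS : StableSet lam S) :
    StableSet lam (pieceMap lam b c ⁻¹' S ∩ {q | 0 ≤ q.1}) := fun _ hp _ hq =>
  (stable_pullback_nonneg h0 h1 hb hc hp.2 hq.2 (hS _ hp.1 _ hq.1)).1

/-- Pulling back away from the singular line, on the left. -/
theorem SimpleAt.preimage_nonpos {lam b c : ℝ} (h0 : 0 < lam) (h1 : lam < 1)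
    (hb : 1 + lam < b) (hc : 0 ≤ c)
    {C : Set (ℝ × ℝ)} {z : ℝ × ℝ} (hz : z.1 ≤ 0)
    (h : SimpleAt lam C (pieceMap lam b c z)) :
    SimpleAt lam (pieceMap lam b c ⁻¹' C ∩ {q | q.1 ≤ 0}) z := by
  rcases h with h | ⟨S₁, S₂, hS1, hS2, hC, hs, hsign⟩
  · exact Or.inl (h.preimage_nonpos h0 h1 hb hc)
  · refine Or.inr ⟨_, _, hS1.preimage_nonpos h0 h1 hb hc, hS2.preimage_nonpos h0 h1 hb hc,
      fun q hq => ?_, fun q hq => ?_, ?_⟩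
    · exact (hC hq.1).imp (fun h => ⟨h, hq.2⟩) (fun h => ⟨h, hq.2⟩)
    · exact (stable_pullback_nonpos h0 h1 hb hc hz hq.2 (hs _ hq.1)).1
    · refine hsign.imp (fun h q hq => ?_) (fun h q hq => ?_)
      all_goals
        obtain ⟨-, a1, a2, a3, a4⟩ := stable_pullback_nonpos h0 h1 hb hc hz hq.2 (hs _ hq.1)
      · exact a1 (a3 (h _ hq.1))
      · exact a2 (a4 (h _ hq.1))

/-- Pulling back away from the singular line, on the right. -/
theorem SimpleAt.preimage_nonneg {lam b c : ℝ} (h0 : 0 < lam) (h1 : lam < 1)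
    (hb : 1 + lam < b) (hc : 0 ≤ c)
    {C : Set (ℝ × ℝ)} {z : ℝ × ℝ} (hz : 0 ≤ z.1)
    (h : SimpleAt lam C (pieceMap lam b c z)) :
    SimpleAt lam (pieceMap lam b c ⁻¹' C ∩ {q | 0 ≤ q.1}) z := by
  rcases h with h | ⟨S₁, S₂, hS1, hS2, hC, hs, hsign⟩
  · exact Or.inl (h.preimage_nonneg h0 h1 hb hc)
  · refine Or.inr ⟨_, _, hS1.preimage_nonneg h0 h1 hb hc, hS2.preimage_nonneg h0 h1 hb hc,
      fun q hq => ?_, fun q hq => ?_, ?_⟩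
    · exact (hC hq.1).imp (fun h => ⟨h, hq.2⟩) (fun h => ⟨h, hq.2⟩)
    · exact (stable_pullback_nonneg h0 h1 hb hc hz hq.2 (hs _ hq.1)).1
    -- On the right the pullback exchanges the upper and lower halves of the cone.
    · refine hsign.symm.imp (fun h q hq => ?_) (fun h q hq => ?_)
      all_goals
        obtain ⟨-, a1, a2, a3, a4⟩ := stable_pullback_nonneg h0 h1 hb hc hz hq.2 (hs _ hq.1)
      · exact a1 (a4 (h _ hq.1))
      · exact a2 (a3 (h _ hq.1))

/-- Pulling back at a point of the singular line. -/
theorem SimpleAt.preimage_of_eq_zero {lam b c : ℝ} (h0 : 0 < lam) (h1 : lam < 1)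
    (hb : 1 + lam < b) (hc : 0 ≤ c)
    {C : Set (ℝ × ℝ)} {z : ℝ × ℝ} (hz : z.1 = 0)
    (hzC : pieceMap lam b c z ∈ C) (h : SimpleAt lam C (pieceMap lam b c z)) :
    SimpleAt lam (pieceMap lam b c ⁻¹' C) z := by
  rcases h with h | ⟨S₁, S₂, hS1, hS2, hC, hs, hsign⟩
  -- The first fold: the left and right pieces both lie above `z`, so they sit in one half of the
  -- stable cone.
  · have key : ∀ q ∈ pieceMap lam b c ⁻¹' C, 0 ≤ formS lam (q - z) ∧ 0 ≤ (q - z).2 := by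
      intro q hq
      have hq' := h _ hzC _ hq
      rcases le_total q.1 0 with hq1 | hq1
      · have := stable_pullback_nonpos h0 h1 hb hc hz.le hq1 hq'
        exact ⟨this.1, this.2.1 (by simp [hz, hq1])⟩
      · have := stable_pullback_nonneg h0 h1 hb hc hz.ge hq1 hq'
        exact ⟨this.1, this.2.1 (by simp [hz, hq1])⟩
    refine Or.inr ⟨_, _, h.preimage_nonpos h0 h1 hb hc, h.preimage_nonneg h0 h1 hb hc,
      fun q hq => ?_, fun q hq => (key q hq).1, Or.inl fun q hq => (key q hq).2⟩
    exact (le_total q.1 0).imp (fun h => ⟨hq, h⟩) (fun h => ⟨hq, h⟩)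
  -- A set already confined to a half cone has its whole preimage on one side of `x = 0`. It cannot
  -- be folded again, which is why two pieces always suffice.
  · have hside : ∀ q ∈ pieceMap lam b c ⁻¹' C,
        (0 ≤ (pieceMap lam b c q - pieceMap lam b c z).2 → q.1 ≤ 0) ∧
        ((pieceMap lam b c q - pieceMap lam b c z).2 ≤ 0 → 0 ≤ q.1) := by
      intro q hq
      rcases le_total q.1 0 with hq1 | hq1
      · obtain ⟨-, -, -, a, b⟩ := stable_pullback_nonpos h0 h1 hb hc hz.le hq1 (hs _ hq)
        exact ⟨fun h => by simpa [hz] using a h, fun h => by simpa [hz] using b h⟩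
      · obtain ⟨-, -, -, a, b⟩ := stable_pullback_nonneg h0 h1 hb hc hz.ge hq1 (hs _ hq)
        exact ⟨fun h => by simpa [hz] using a h, fun h => by simpa [hz] using b h⟩
    have hsimple : SimpleAt lam C (pieceMap lam b c z) :=
      Or.inr ⟨S₁, S₂, hS1, hS2, hC, hs, hsign⟩
    rcases hsign with hsign | hsign
    · have : pieceMap lam b c ⁻¹' C = pieceMap lam b c ⁻¹' C ∩ {q | q.1 ≤ 0} :=
        (inter_eq_left.2 fun q hq => (hside q hq).1 (hsign _ hq)).symm
      rw [this]
      exact hsimple.preimage_nonpos h0 h1 hb hc hz.le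
    · have : pieceMap lam b c ⁻¹' C = pieceMap lam b c ⁻¹' C ∩ {q | 0 ≤ q.1} :=
        (inter_eq_left.2 fun q hq => (hside q hq).2 (hsign _ hq)).symm
      rw [this]
      exact hsimple.preimage_nonneg h0 h1 hb hc hz.ge

theorem SimpleAt.mono {lam : ℝ} {C C' : Set (ℝ × ℝ)} {z : ℝ × ℝ} (h : SimpleAt lam C z)
    (hC : C' ⊆ C) : SimpleAt lam C' z := by
  rcases h with h | ⟨S₁, S₂, hS1, hS2, h3, hs, hsign⟩
  · exact Or.inl (h.mono hC)
  · exact Or.inr ⟨S₁, S₂, hS1, hS2, hC.trans h3, fun q hq => hs q (hC hq),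
      hsign.imp (fun h q hq => h q (hC hq)) (fun h q hq => h q (hC hq))⟩

/-- The number of pieces does not grow with `i`: away from `x = 0` a pullback preserves `SimpleAt`,
and on the line a single piece folds once while a folded one stays on one side. -/
theorem exists_nhds_simpleAt_crossing {lam b c : ℝ} (h0 : 0 < lam) (h1 : lam < 1)
    (hb : 1 + lam < b) (hc : 0 ≤ c) (i : ℕ) (z : ℝ × ℝ) :
    ∃ U ∈ 𝓝 z, SimpleAt lam (crossing lam b c i ∩ U) z := by
  induction i generalizing z with
  | zero =>
    refine ⟨univ, univ_mem, Or.inl fun p hp q hq => ?_⟩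
    have hp : p.1 = 0 := hp.1
    have hq : q.1 = 0 := hq.1
    simp only [formS, Prod.fst_sub, hp, hq, Prod.snd_sub]
    nlinarith [sq_nonneg (q.2 - p.2)]
  | succ i ih =>
    obtain ⟨U', hU', hs⟩ := ih (pieceMap lam b c z)
    have hcont := continuous_pieceMap lam b c
    have hpre : pieceMap lam b c ⁻¹' U' ∈ 𝓝 z := hcont.continuousAt hU'
    have hcross : crossing lam b c (i + 1) = pieceMap lam b c ⁻¹' crossing lam b c i := by
      ext q; simp [crossing]
    rcases lt_trichotomy z.1 0 with hz | hz | hz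
    · refine ⟨pieceMap lam b c ⁻¹' U' ∩ {q | q.1 ≤ 0}, inter_mem hpre ?_, ?_⟩
      · filter_upwards [continuous_fst.continuousAt.eventually_lt_const hz] with q hq using hq.le
      · refine (hs.preimage_nonpos h0 h1 hb hc hz.le).mono ?_
        rw [hcross]; exact fun q hq => ⟨⟨hq.1, hq.2.1⟩, hq.2.2⟩
    · by_cases hzC : z ∈ crossing lam b c (i + 1)
      · refine ⟨_, hpre, ?_⟩
        rw [hcross] at hzC ⊢
        exact SimpleAt.preimage_of_eq_zero (C := crossing lam b c i ∩ U') h0 h1 hb hc hz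
          ⟨hzC, mem_of_mem_nhds hU'⟩ hs
      -- The fold argument needs its vertex in the set. Otherwise the closed set `crossing` misses a
      -- neighbourhood of `z`.
      · refine ⟨(crossing lam b c (i + 1))ᶜ, IsOpen.mem_nhds ?_ hzC, ?_⟩
        · rw [isOpen_compl_iff]
          exact isClosed_eq (continuous_fst.comp (hcont.iterate _)) continuous_const
        · rw [inter_compl_self]; exact Or.inl fun p hp => hp.elim
    · refine ⟨pieceMap lam b c ⁻¹' U' ∩ {q | 0 ≤ q.1}, inter_mem hpre ?_, ?_⟩
      · filter_upwards [continuous_fst.continuousAt.eventually_const_lt hz] with q hq using hq.le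
      · refine (hs.preimage_nonneg h0 h1 hb hc hz.le).mono ?_
        rw [hcross]; exact fun q hq => ⟨⟨hq.1, hq.2.1⟩, hq.2.2⟩

theorem exists_uniform_cover_crossing {lam b c : ℝ} (h0 : 0 < lam) (h1 : lam < 1)
    (hb : 1 + lam < b) (hc : 0 ≤ c) {K : Set (ℝ × ℝ)} (hK : IsCompact K) (N : ℕ) :
    ∃ r > 0, ∀ p ∈ K, ∀ i < N, ∃ S₁ S₂, StableSet lam S₁ ∧ StableSet lam S₂ ∧
      crossing lam b c i ∩ Metric.ball p r ⊆ S₁ ∪ S₂ := by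
  choose U hU hs using exists_nhds_simpleAt_crossing h0 h1 hb hc
  obtain ⟨r, hr, h⟩ := lebesgue_number_lemma_of_metric (c := fun z => interior (⋂ i ∈ Iio N, U i z))
    hK (fun z => isOpen_interior) (fun z _ => mem_iUnion.2 ⟨z, mem_interior_iff_mem_nhds.2
      ((biInter_mem (finite_Iio N)).2 fun i _ => hU i z)⟩)
  refine ⟨r, hr, fun p hp i hi => ?_⟩
  obtain ⟨z, hz⟩ := h p hp
  refine ((hs i z).mono (inter_subset_inter_right _ ?_)).exists_cover
  exact (hz.trans interior_subset).trans (biInter_subset_of_mem hi)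

/-! ### Growth of unstable arcs -/

/-- All chords of the curve lie in the closed unstable cone and are not degenerate. -/
def UnstableArc (lam : ℝ) (γ : ℝ → ℝ × ℝ) (s t : ℝ) : Prop :=
  ∀ u ∈ Icc s t, ∀ v ∈ Icc s t, u < v → 0 ≤ formU lam (γ v - γ u) ∧ (γ v - γ u).1 ≠ 0

theorem UnstableArc.subarc {lam : ℝ} {γ : ℝ → ℝ × ℝ} {s t s' t' : ℝ} (h : UnstableArc lam γ s t)
    (hs : s ≤ s') (ht : t' ≤ t) : UnstableArc lam γ s' t' :=
  fun u hu v hv => h u (Icc_subset_Icc hs ht hu) v (Icc_subset_Icc hs ht hv)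

/-- Transversality of the cones: a chord that is both stable and unstable vanishes. -/
theorem UnstableArc.eq_of_mem_stableSet {lam : ℝ} (h0 : 0 < lam) (h1 : lam < 1)
    {γ : ℝ → ℝ × ℝ} {s t : ℝ} (h : UnstableArc lam γ s t) {S : Set (ℝ × ℝ)} (hS : StableSet lam S)
    {u v : ℝ} (hu : u ∈ Icc s t) (hv : v ∈ Icc s t) (huS : γ u ∈ S) (hvS : γ v ∈ S) : u = v := by
  by_contra hne
  rcases lt_or_gt_of_ne hne with hlt | hlt
  · obtain ⟨a, b⟩ := h u hu v hv hlt
    exact b (by rw [eq_zero_of_formU_formS_nonneg h0 h1 a (hS _ huS _ hvS)]; rfl)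
  · obtain ⟨a, b⟩ := h v hv u hu hlt
    exact b (by rw [eq_zero_of_formU_formS_nonneg h0 h1 a (hS _ hvS _ huS)]; rfl)

theorem UnstableArc.exists_pair {lam : ℝ} (h0 : 0 < lam) (h1 : lam < 1)
    {γ : ℝ → ℝ × ℝ} {s t : ℝ} (h : UnstableArc lam γ s t) {S₁ S₂ : Set (ℝ × ℝ)}
    (hS1 : StableSet lam S₁) (hS2 : StableSet lam S₂) :
    ∃ u v : ℝ, ∀ τ ∈ Icc s t, γ τ ∈ S₁ ∪ S₂ → τ = u ∨ τ = v := by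
  have key : ∀ S, StableSet lam S → ∃ u : ℝ, ∀ τ ∈ Icc s t, γ τ ∈ S → τ = u := by
    intro S hS
    by_cases hex : ∃ u ∈ Icc s t, γ u ∈ S
    · obtain ⟨u, hu, huS⟩ := hex
      exact ⟨u, fun τ hτ hτS => h.eq_of_mem_stableSet h0 h1 hS hτ hu hτS huS⟩
    · exact ⟨0, fun τ hτ hτS => (hex ⟨τ, hτ, hτS⟩).elim⟩
  obtain ⟨u, hu⟩ := key _ hS1
  obtain ⟨v, hv⟩ := key _ hS2
  exact ⟨u, v, fun τ hτ hτS => hτS.imp (hu τ hτ) (hv τ hτ)⟩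

theorem same_sign_of_no_zero {g : ℝ → ℝ} (hg : Continuous g) {s t : ℝ} (hst : s < t)
    (h : ∀ τ ∈ Ioo s t, g τ ≠ 0) : (∀ τ ∈ Icc s t, g τ ≤ 0) ∨ ∀ τ ∈ Icc s t, 0 ≤ g τ := by
  have hcl : closure (Ioo s t) = Icc s t := closure_Ioo hst.ne
  have hIoo : (∀ τ ∈ Ioo s t, g τ ≤ 0) ∨ ∀ τ ∈ Ioo s t, 0 ≤ g τ := by
    by_contra! hcon
    obtain ⟨⟨u, hu, hgu⟩, v, hv, hgv⟩ := hcon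
    obtain ⟨w, hw, hw0⟩ := isPreconnected_Ioo.intermediate_value hv hu hg.continuousOn
      ⟨hgv.le, hgu.le⟩
    exact h w hw hw0
  rw [← hcl]
  refine hIoo.imp (fun h τ hτ => ?_) (fun h τ hτ => ?_)
  · exact closure_minimal (t := {τ | g τ ≤ 0}) h (isClosed_le hg continuous_const) hτ
  · exact closure_minimal (t := {τ | 0 ≤ g τ}) h (isClosed_le continuous_const hg) hτ

/-- An arc whose interior misses `x = 0` lies in one closed half-plane, where every chord is mapped
by some `lin lam T`. -/
theorem UnstableArc.map {lam b c : ℝ} (h0 : 0 < lam) (hb : 1 + lam < b) (hc : 0 ≤ c)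
    {γ : ℝ → ℝ × ℝ} (hγ : Continuous γ) {s t : ℝ} (hst : s < t) (h : UnstableArc lam γ s t)
    (hz : ∀ τ ∈ Ioo s t, (γ τ).1 ≠ 0) :
    UnstableArc lam (pieceMap lam b c ∘ γ) s t ∧
      (b - lam) * |(γ t - γ s).1| ≤
        |(pieceMap lam b c (γ t) - pieceMap lam b c (γ s)).1| := by
  have key : ∀ u ∈ Icc s t, ∀ v ∈ Icc s t, ∃ T, (b ≤ T ∨ T ≤ -b) ∧
      pieceMap lam b c (γ v) - pieceMap lam b c (γ u) = lin lam T (γ v - γ u) := by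
    intro u hu v hv
    rcases same_sign_of_no_zero (continuous_fst.comp hγ) hst hz with hs | hs
    · obtain ⟨T, hT, e⟩ := secant_nonpos (lam := lam) (b := b) hc (hs u hu) (hs v hv)
      exact ⟨T, Or.inl hT, e⟩
    · obtain ⟨T, hT, e⟩ := secant_nonneg (lam := lam) (b := b) hc (hs u hu) (hs v hv)
      exact ⟨T, Or.inr hT, e⟩
  constructor
  · intro u hu v hv huv
    obtain ⟨T, hT, e⟩ := key u hu v hv
    obtain ⟨hU, hne⟩ := h u hu v hv huv
    simp only [Function.comp_apply, e]
    refine ⟨formU_lin_nonneg h0 hb hT hU, abs_pos.1 ?_⟩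
    exact lt_of_lt_of_le (mul_pos (by linarith) (abs_pos.2 hne)) (expand_fst h0 hT hU)
  · obtain ⟨T, hT, e⟩ := key s (left_mem_Icc.2 hst.le) t (right_mem_Icc.2 hst.le)
    rw [e]
    exact expand_fst h0 hT (h s (left_mem_Icc.2 hst.le) t (right_mem_Icc.2 hst.le) hst).1

theorem UnstableArc.iterate {lam b c : ℝ} (h0 : 0 < lam) (hb : 1 + lam < b) (hc : 0 ≤ c)
    {γ : ℝ → ℝ × ℝ} (hγ : Continuous γ) {s t : ℝ} (hst : s < t) (h : UnstableArc lam γ s t)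
    (N : ℕ) (hz : ∀ i < N, ∀ τ ∈ Ioo s t, γ τ ∉ crossing lam b c i) :
    UnstableArc lam ((pieceMap lam b c)^[N] ∘ γ) s t ∧
      (b - lam) ^ N * |(γ t - γ s).1| ≤
        |((pieceMap lam b c)^[N] (γ t) - (pieceMap lam b c)^[N] (γ s)).1| := by
  induction N with
  | zero => exact ⟨h, by simp⟩
  | succ N ih =>
    obtain ⟨ih1, ih2⟩ := ih fun i hi => hz i (by omega)
    have := ih1.map h0 hb hc (((continuous_pieceMap lam b c).iterate N).comp hγ) hst
      (hz N (by omega))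
    rw [Function.iterate_succ']
    refine ⟨this.1, le_trans ?_ this.2⟩
    rw [pow_succ', mul_assoc]
    exact mul_le_mul_of_nonneg_left ih2 (by linarith)

/-- Some gap between the points of a finite set has a good share of the total extent. -/
theorem exists_large_gap (e : ℝ → ℝ) (n : ℕ) : ∀ (Z : Finset ℝ) (s t : ℝ), Z.card ≤ n → s < t →
    ∃ s' t', s ≤ s' ∧ s' < t' ∧ t' ≤ t ∧ (∀ τ ∈ Ioo s' t', τ ∉ Z) ∧
      |e t - e s| ≤ (Z.card + 1) * |e t' - e s'| := by
  classical
  induction n with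
  | zero =>
    intro Z s t hZ hst
    have : Z = ∅ := Finset.card_eq_zero.1 (by omega)
    subst this
    exact ⟨s, t, le_rfl, hst, le_rfl, by simp, by simp⟩
  | succ n ih =>
    intro Z s t hZ hst
    by_cases hex : ∃ z ∈ Ioo s t, z ∈ Z
    · obtain ⟨z, hz, hzZ⟩ := hex
      set A := Z.filter (· < z)
      set B := Z.filter (z < ·)
      -- The point `z` itself is in neither part, so the gap counts `|A| + 1` and `|B| + 1` add up
      -- to at most `|Z| + 1`.
      have hcard : A.card + B.card + 1 ≤ Z.card := by
        have hd : Disjoint A B := by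
          rw [Finset.disjoint_left]
          intro x hx hx'
          exact lt_asymm (Finset.mem_filter.1 hx).2 (Finset.mem_filter.1 hx').2
        rw [← Finset.card_union_of_disjoint hd, ← Finset.card_erase_add_one hzZ]
        refine Nat.add_le_add_right (Finset.card_le_card fun x hx => ?_) 1
        rcases Finset.mem_union.1 hx with hx | hx
        · exact Finset.mem_erase.2 ⟨(Finset.mem_filter.1 hx).2.ne, (Finset.mem_filter.1 hx).1⟩
        · exact Finset.mem_erase.2 ⟨(Finset.mem_filter.1 hx).2.ne', (Finset.mem_filter.1 hx).1⟩
      obtain ⟨s₁, t₁, a1, a2, a3, a4, a5⟩ := ih A s z (by omega) hz.1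
      obtain ⟨s₂, t₂, b1, b2, b3, b4, b5⟩ := ih B z t (by omega) hz.2
      have htri : |e t - e s| ≤ |e z - e s| + |e t - e z| := by
        have := abs_add_le (e z - e s) (e t - e z)
        rwa [show e z - e s + (e t - e z) = e t - e s by ring] at this
      have hcard' : (A.card + B.card + 1 : ℝ) ≤ Z.card := by exact_mod_cast hcard
      rcases le_total |e t₁ - e s₁| |e t₂ - e s₂| with hle | hle
      · refine ⟨s₂, t₂, hz.1.le.trans b1, b2, b3, fun τ hτ hτZ => b4 τ hτ ?_, ?_⟩
        · exact Finset.mem_filter.2 ⟨hτZ, lt_of_le_of_lt b1 hτ.1⟩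
        · nlinarith [abs_nonneg (e t₂ - e s₂), (Nat.cast_nonneg A.card : (0 : ℝ) ≤ _)]
      · refine ⟨s₁, t₁, a1, a2, a3.trans hz.2.le, fun τ hτ hτZ => a4 τ hτ ?_, ?_⟩
        · exact Finset.mem_filter.2 ⟨hτZ, lt_of_lt_of_le hτ.2 a3⟩
        · nlinarith [abs_nonneg (e t₁ - e s₁), (Nat.cast_nonneg B.card : (0 : ℝ) ≤ _)]
    · push Not at hex
      refine ⟨s, t, le_rfl, hst, le_rfl, hex, ?_⟩
      nlinarith [abs_nonneg (e t - e s), (Nat.cast_nonneg Z.card : (0 : ℝ) ≤ _)]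

theorem exists_expansion_beats_complexity {θ : ℝ} (hθ : 1 < θ) :
    ∃ N : ℕ, 2 * (2 * N + 1) ≤ θ ^ N := by
  -- The bound `1/8` yields `8N < θ^N`, and `2 (2N + 1) ≤ 6N` once `N ≥ 1`.
  have h := (tendsto_pow_const_div_const_pow_of_one_lt 1 hθ).eventually_lt_const
    (show (0 : ℝ) < 1 / 8 by norm_num)
  obtain ⟨N, hN, hN1⟩ := (h.and (eventually_ge_atTop 1)).exists
  refine ⟨N, ?_⟩
  have hp : 0 < θ ^ N := by positivity
  rw [pow_one, div_lt_iff₀ hp] at hN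
  have : (1 : ℝ) ≤ N := by exact_mod_cast hN1
  linarith

/-- A short unstable arc contains a subarc whose extent doubles in `N` steps. -/
theorem UnstableArc.exists_doubling {lam b c : ℝ} (h0 : 0 < lam) (h1 : lam < 1)
    (hb : 1 + lam < b) (hc : 0 ≤ c) {N : ℕ} (hN : 2 * (2 * N + 1) ≤ (b - lam) ^ N)
    {U : Set (ℝ × ℝ)} (hU : ∀ i < N, ∃ S₁ S₂, StableSet lam S₁ ∧ StableSet lam S₂ ∧
      crossing lam b c i ∩ U ⊆ S₁ ∪ S₂)
    {γ : ℝ → ℝ × ℝ} (hγ : Continuous γ) {s t : ℝ} (hst : s < t) (h : UnstableArc lam γ s t)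
    (hγU : ∀ τ ∈ Icc s t, γ τ ∈ U) :
    ∃ s' t', s ≤ s' ∧ s' < t' ∧ t' ≤ t ∧
      UnstableArc lam ((pieceMap lam b c)^[N] ∘ γ) s' t' ∧
      2 * |(γ t - γ s).1| ≤
        |((pieceMap lam b c)^[N] (γ t') - (pieceMap lam b c)^[N] (γ s')).1| := by
  classical
  have hpair : ∀ i, ∃ u v : ℝ, i < N →
      ∀ τ ∈ Icc s t, γ τ ∈ crossing lam b c i → τ = u ∨ τ = v := by
    intro i
    by_cases hi : i < N
    · obtain ⟨S₁, S₂, hS1, hS2, hsub⟩ := hU i hi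
      obtain ⟨u, v, huv⟩ := h.exists_pair h0 h1 hS1 hS2
      exact ⟨u, v, fun _ τ hτ hc => huv τ hτ (hsub ⟨hc, hγU τ hτ⟩)⟩
    · exact ⟨0, 0, fun h => (hi h).elim⟩
  choose u v huv using hpair
  set Z := (Finset.range N).image u ∪ (Finset.range N).image v with hZ
  have hcard : Z.card ≤ 2 * N := by
    refine (Finset.card_union_le _ _).trans ?_
    have a := Finset.card_image_le (s := Finset.range N) (f := u)
    have b := Finset.card_image_le (s := Finset.range N) (f := v)
    rw [Finset.card_range] at a b
    omega
  obtain ⟨s', t', hs, hst', ht, hgap, hext⟩ :=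
    exists_large_gap (fun τ => (γ τ).1) _ Z s t le_rfl hst
  obtain ⟨harc, hexp⟩ := (h.subarc hs ht).iterate (c := c) h0 hb hc hγ hst' N (by
    intro i hi τ hτ hcr
    refine hgap τ hτ ?_
    have hi' := Finset.mem_range.2 hi
    rcases huv i hi τ ⟨hs.trans hτ.1.le, hτ.2.le.trans ht⟩ hcr with e | e
    · exact Finset.mem_union_left _ (Finset.mem_image.2 ⟨i, hi', e.symm⟩)
    · exact Finset.mem_union_right _ (Finset.mem_image.2 ⟨i, hi', e.symm⟩))
  refine ⟨s', t', hs, hst', ht, harc, le_trans ?_ hexp⟩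
  have hcard' : (Z.card : ℝ) ≤ 2 * N := by exact_mod_cast hcard
  have hnn := abs_nonneg ((γ t' - γ s').1)
  calc 2 * |(γ t - γ s).1| ≤ 2 * ((Z.card + 1) * |(γ t' - γ s').1|) :=
        mul_le_mul_of_nonneg_left hext (by norm_num)
    _ ≤ 2 * ((2 * N + 1) * |(γ t' - γ s').1|) := by gcongr
    _ = 2 * (2 * N + 1) * |(γ t' - γ s').1| := by ring
    _ ≤ (b - lam) ^ N * |(γ t' - γ s').1| := mul_le_mul_of_nonneg_right hN hnn

/-! ### Sensitive dependence -/

theorem isSensitiveOn_of_isCompact {lam b c : ℝ} (h0 : 0 < lam) (h1 : lam < 1)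
    (hb : 1 + lam < b) (hc : 0 ≤ c) {K A : Set (ℝ × ℝ)} (hK : IsCompact K)
    (hA : ∀ p ∈ A, ∀ n, (pieceMap lam b c)^[n] p ∈ K) :
    IsSensitiveOn (pieceMap lam b c) A := by
  obtain ⟨N, hN⟩ := exists_expansion_beats_complexity (θ := b - lam) (by linarith)
  obtain ⟨r, hr, hcov⟩ := exists_uniform_cover_crossing h0 h1 hb hc hK N
  refine ⟨r, hr, fun p hp ε hε => ?_⟩
  by_contra! hcon
  set F := pieceMap lam b c with hF
  -- A horizontal segment has its chords on the boundary of the unstable cone, which the closed cone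
  -- allows.
  set γ : ℝ → ℝ × ℝ := fun τ => (p.1 + τ, p.2) with hγd
  have hγ : Continuous γ := by fun_prop
  have hnear : ∀ τ ∈ Icc 0 (ε / 2), ∀ n, dist (F^[n] (γ τ)) (F^[n] p) < r := by
    intro τ hτ n
    rw [dist_comm]
    refine hcon _ ?_ n
    rw [Prod.dist_eq, max_lt_iff]
    constructor
    · simp only [hγd, Real.dist_eq]
      rw [abs_sub_comm, add_sub_cancel_left, abs_of_nonneg hτ.1]
      linarith [hτ.2]
    · simpa [hγd] using hε
  -- If all these orbits stay within `r` of the orbit of `p`, the arc always lies in a ball where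
  -- the two-piece cover is valid, so doubling can be repeated forever; but its extent is below
  -- `2r`.
  have grow : ∀ m : ℕ, ∃ s t, 0 ≤ s ∧ s < t ∧ t ≤ ε / 2 ∧
      UnstableArc lam (F^[N * m] ∘ γ) s t ∧
      2 ^ m * (ε / 2) ≤ |(F^[N * m] (γ t) - F^[N * m] (γ s)).1| := by
    intro m
    induction m with
    | zero =>
      refine ⟨0, ε / 2, le_rfl, by positivity, le_rfl, fun u _ v _ huv => ⟨?_, ?_⟩, ?_⟩
      · simp [hγd, formU]
      · simpa [hγd] using (sub_pos.2 huv).ne'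
      · simp [hγd, le_abs_self]
    | succ m ih =>
      obtain ⟨s, t, hs, hst, ht, harc, hext⟩ := ih
      obtain ⟨s', t', hs', hst', ht', harc', hext'⟩ :=
        harc.exists_doubling h0 h1 hb hc hN (U := Metric.ball (F^[N * m] p) r)
          (fun i hi => hcov _ (hA p hp _) i hi)
          (((continuous_pieceMap lam b c).iterate _).comp hγ) hst
          (fun τ hτ => hnear τ ⟨hs.trans hτ.1, hτ.2.trans ht⟩ _)
      have hit : F^[N * (m + 1)] = F^[N] ∘ F^[N * m] := by
        rw [← Function.iterate_add, Nat.mul_succ, Nat.add_comm]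
      refine ⟨s', t', hs.trans hs', hst', ht'.trans ht, ?_, ?_⟩
      · rw [hit]; exact harc'
      · rw [hit, pow_succ']
        exact le_trans (by rw [mul_assoc]; exact mul_le_mul_of_nonneg_left hext (by norm_num))
          hext'
  obtain ⟨m, hm⟩ := pow_unbounded_of_one_lt (2 * r / (ε / 2)) (one_lt_two (α := ℝ))
  obtain ⟨s, t, hs, hst, ht, -, hext⟩ := grow m
  rw [div_lt_iff₀ (by positivity)] at hm
  have hd1 := hnear s ⟨hs, hst.le.trans ht⟩ (N * m)
  have hd2 := hnear t ⟨hs.trans hst.le, ht⟩ (N * m)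
  have hd3 : dist (F^[N * m] (γ t)).1 (F^[N * m] (γ s)).1 ≤
      dist (F^[N * m] (γ t)) (F^[N * m] (γ s)) := by
    rw [Prod.dist_eq]; exact le_max_left _ _
  rw [Real.dist_eq] at hd3
  rw [Prod.fst_sub] at hext
  have := dist_triangle_right (F^[N * m] (γ t)) (F^[N * m] (γ s)) (F^[N * m] p)
  linarith

/-! ### Backward orbits on the left half-plane

The abscissae `u n` of a backward orbit in `x ≤ 0` satisfy `Φ (u (n + 1)) = u n + λ u (n + 2)` with
`Φ u = 1 + b u + c u |u|`, and its ordinates are `λ (u n - u (n + 1))`. -/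

/-- The strictly increasing function `1 + b u + c u |u|`. -/
def backPhi (b c u : ℝ) : ℝ := 1 + b * u + c * (u * |u|)

/-- Bounded solutions of the recurrence for backward orbits that start at `x`. -/
def IsBackward (lam b c x : ℝ) (u : ℕ → ℝ) : Prop :=
  u 0 = x ∧ (∃ B, ∀ n, |u n| ≤ B) ∧ ∀ n, backPhi b c (u (n + 1)) = u n + lam * u (n + 2)

theorem mul_abs_self_le {u v : ℝ} (h : u ≤ v) : u * |u| ≤ v * |v| := by
  rcases le_total 0 u with hu | hu
  · rw [abs_of_nonneg hu, abs_of_nonneg (hu.trans h)]; nlinarith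
  · rw [abs_of_nonpos hu]
    rcases le_total 0 v with hv | hv
    · rw [abs_of_nonneg hv]; nlinarith
    · rw [abs_of_nonpos hv]; nlinarith

theorem backPhi_sub_ge {b c : ℝ} (hc : 0 ≤ c) {u v : ℝ} (h : u ≤ v) :
    b * (v - u) ≤ backPhi b c v - backPhi b c u := by
  have := mul_le_mul_of_nonneg_left (mul_abs_self_le h) hc
  simp only [backPhi]; linarith

theorem backPhi_surjective {b c : ℝ} (hb : 0 < b) (hc : 0 ≤ c) :
    Function.Surjective (backPhi b c) := by
  have hcont : Continuous (backPhi b c) := by unfold backPhi; fun_prop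
  intro y
  have h1 : (0 : ℝ) ≤ |y - 1| / b := by positivity
  have e : b * (|y - 1| / b) = |y - 1| := by field_simp
  have hlow := backPhi_sub_ge (b := b) hc (u := -(|y - 1| / b)) (v := 0) (by linarith)
  have hup := backPhi_sub_ge (b := b) hc (u := 0) (v := |y - 1| / b) h1
  have h00 : backPhi b c 0 = 1 := by simp [backPhi]
  rw [h00] at hlow hup
  obtain ⟨x, -, hx⟩ := intermediate_value_Icc (show -(|y - 1| / b) ≤ |y - 1| / b by linarith)
    hcont.continuousOn (show y ∈ Icc _ _ from
      ⟨by linarith [neg_abs_le (y - 1)], by linarith [le_abs_self (y - 1)]⟩)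
  exact ⟨x, hx⟩

/-- A bounded sequence that is subharmonic where it is nonnegative is bounded by its initial
value. -/
theorem le_of_subharmonic {lam b B : ℝ} (h0 : 0 < lam) (hb : 1 + lam < b) (hB : 0 ≤ B)
    {d : ℕ → ℝ} (hd : BddAbove (range d)) (hd0 : d 0 ≤ B)
    (hstep : ∀ n, 0 ≤ d (n + 1) → b * d (n + 1) ≤ d n + lam * d (n + 2)) (n : ℕ) : d n ≤ B := by
  set S := sSup (range d)
  have hS : ∀ n, d n ≤ S := fun n => le_csSup hd (mem_range_self n)
  by_contra! hn
  have hSB : B < S := hn.trans_le (hS n)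
  have hb0 : 0 < b := by linarith
  have hρ : (1 + lam) / b * S < S := by
    have : (1 + lam) / b < 1 := by rw [div_lt_one hb0]; exact hb
    nlinarith
  -- At a positive index with a nonnegative term the recurrence gives at most `(1 + λ) S / b`,
  -- strictly below `S`.
  have hle : S ≤ max B ((1 + lam) / b * S) := by
    refine csSup_le (range_nonempty d) ?_
    rintro _ ⟨n, rfl⟩
    rcases n with _ | n
    · exact le_max_of_le_left hd0
    · rcases lt_or_ge (d (n + 1)) 0 with h | h
      · exact le_max_of_le_left (h.le.trans hB)
      · refine le_max_of_le_right ?_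
        rw [div_mul_eq_mul_div, le_div_iff₀ hb0]
        nlinarith [hstep n h, hS n, hS (n + 2)]
  exact absurd hle (not_le.2 (max_lt hSB hρ))

/-- Differences of two solutions, in either order, are subharmonic where nonnegative, because
`backPhi` has slope at least `b`. -/
theorem IsBackward.compare {lam b c x y : ℝ} (h0 : 0 < lam) (hb : 1 + lam < b) (hc : 0 ≤ c)
    {u v : ℕ → ℝ} (hu : IsBackward lam b c x u) (hv : IsBackward lam b c y v) (hxy : x ≤ y)
    (n : ℕ) : u n ≤ v n ∧ v n - u n ≤ y - x := by
  obtain ⟨hu0, ⟨B, hB⟩, hu⟩ := hu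
  obtain ⟨hv0, ⟨B', hB'⟩, hv⟩ := hv
  have hbd : ∀ n, |v n - u n| ≤ B' + B := fun n =>
    (abs_sub _ _).trans (add_le_add (hB' n) (hB n))
  constructor
  · have := le_of_subharmonic h0 hb le_rfl (d := fun n => u n - v n)
      ⟨B' + B, by rintro _ ⟨n, rfl⟩; exact (le_abs_self _).trans ((abs_sub_comm _ _).trans_le (hbd n))⟩
      (by simp only [hu0, hv0]; linarith) (fun n hn => by
        have := backPhi_sub_ge (b := b) hc (sub_nonneg.1 hn)
        rw [hu, hv] at this; linarith) n
    linarith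
  · exact le_of_subharmonic h0 hb (by linarith) (d := fun n => v n - u n)
      ⟨B' + B, by rintro _ ⟨n, rfl⟩; exact (le_abs_self _).trans (hbd n)⟩
      (by simp only [hu0, hv0]; linarith) (fun n hn => by
        have := backPhi_sub_ge (b := b) hc (sub_nonneg.1 hn)
        rw [hu, hv] at this; linarith) n

theorem IsBackward.unique {lam b c x : ℝ} (h0 : 0 < lam) (hb : 1 + lam < b) (hc : 0 ≤ c)
    {u v : ℕ → ℝ} (hu : IsBackward lam b c x u) (hv : IsBackward lam b c x v) : u = v :=
  funext fun n => le_antisymm (hu.compare h0 hb hc hv le_rfl n).1 (hv.compare h0 hb hc hu le_rfl n).1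

theorem IsBackward.shift {lam b c x : ℝ} {u : ℕ → ℝ} (hu : IsBackward lam b c x u) :
    IsBackward lam b c (u 1) (fun n => u (n + 1)) :=
  ⟨rfl, hu.2.1.imp fun _ h _ => h _, fun n => hu.2.2 (n + 1)⟩

/-- With `ψ` a right inverse of `backPhi`, the recurrence reads `u (n + 1) = ψ (u n + λ u (n + 2))`,
a contraction of ratio `(1 + λ) / b` on bounded sequences. -/
theorem exists_isBackward {lam b c : ℝ} (h0 : 0 < lam) (hb : 1 + lam < b) (hc : 0 ≤ c) (x : ℝ) :
    ∃ u, IsBackward lam b c x u := by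
  have hb0 : 0 < b := by linarith
  obtain ⟨ψ, hψ⟩ := (backPhi_surjective hb0 hc).hasRightInverse
  have hlip : ∀ s t, |ψ s - ψ t| ≤ |s - t| / b := by
    intro s t
    rw [le_div_iff₀ hb0]
    rcases le_total (ψ s) (ψ t) with h | h
    · have := backPhi_sub_ge (b := b) hc h
      rw [hψ, hψ] at this
      rw [abs_of_nonpos (by linarith)]
      linarith [neg_abs_le (s - t)]
    · have := backPhi_sub_ge (b := b) hc h
      rw [hψ, hψ] at this
      rw [abs_of_nonneg (by linarith)]
      linarith [le_abs_self (s - t)]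
  let T : (ℕ → ℝ) → ℕ → ℝ := fun u n => Nat.casesOn n x fun n => ψ (u n + lam * u (n + 2))
  have hT : ∀ u : BoundedContinuousFunction ℕ ℝ, ∀ n,
      ‖T u n‖ ≤ |x| + (|ψ 0| + (1 + lam) * ‖u‖ / b) := by
    intro u n
    have hnn : 0 ≤ |ψ 0| + (1 + lam) * ‖u‖ / b := by positivity
    rcases n with _ | n
    · exact le_add_of_nonneg_right hnn
    · refine le_trans ?_ (le_add_of_nonneg_left (abs_nonneg x))
      have h1 := hlip (u n + lam * u (n + 2)) 0
      have h2 : |u n + lam * u (n + 2) - 0| ≤ (1 + lam) * ‖u‖ := by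
        rw [sub_zero]
        refine (abs_add_le _ _).trans ?_
        rw [abs_mul, abs_of_pos h0, add_mul, one_mul]
        exact add_le_add (u.norm_coe_le_norm n)
          (mul_le_mul_of_nonneg_left (u.norm_coe_le_norm (n + 2)) h0.le)
      have h3 : |u n + lam * u (n + 2) - 0| / b ≤ (1 + lam) * ‖u‖ / b := by gcongr
      have h4 := abs_add_le (ψ 0) (ψ (u n + lam * u (n + 2)) - ψ 0)
      rw [add_sub_cancel] at h4
      change |ψ (u n + lam * u (n + 2))| ≤ _
      linarith
  let T' : BoundedContinuousFunction ℕ ℝ → BoundedContinuousFunction ℕ ℝ := fun u =>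
    BoundedContinuousFunction.ofNormedAddCommGroupDiscrete (T u) _ (hT u)
  have hK : ContractingWith (Real.toNNReal ((1 + lam) / b)) T' := by
    refine ⟨?_, LipschitzWith.of_dist_le_mul fun u v => ?_⟩
    · rw [← NNReal.coe_lt_coe, Real.coe_toNNReal _ (by positivity), NNReal.coe_one, div_lt_one hb0]
      exact hb
    · rw [Real.coe_toNNReal _ (by positivity), BoundedContinuousFunction.dist_le (by positivity)]
      intro n
      rcases n with _ | n
      · change dist x x ≤ _
        rw [dist_self]; positivity
      · change |ψ (u n + lam * u (n + 2)) - ψ (v n + lam * v (n + 2))| ≤ _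
        refine (hlip _ _).trans ?_
        rw [div_mul_eq_mul_div]
        refine div_le_div_of_nonneg_right ?_ hb0.le
        have e : u n + lam * u (n + 2) - (v n + lam * v (n + 2)) =
          (u n - v n) + lam * (u (n + 2) - v (n + 2)) := by ring
        rw [e]
        refine (abs_add_le _ _).trans ?_
        rw [abs_mul, abs_of_pos h0, add_mul, one_mul]
        exact add_le_add (BoundedContinuousFunction.dist_coe_le_dist (f := u) (g := v) n)
          (mul_le_mul_of_nonneg_left
            (BoundedContinuousFunction.dist_coe_le_dist (f := u) (g := v) (n + 2)) h0.le)
  obtain ⟨u, hu, -⟩ := hK.exists_fixedPoint 0 (edist_ne_top _ _)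
  have hu' : ∀ n, T u n = u n := fun n => DFunLike.congr_fun hu n
  refine ⟨u, (hu' 0).symm, ⟨‖u‖, fun n => u.norm_coe_le_norm n⟩, fun n => ?_⟩
  rw [← hu' (n + 1)]
  exact hψ _

/-- The abscissa of the preimage, along the unstable separatrix, of the point of abscissa `x`: the
separatrix is the graph of `x ↦ λ (x - ξ x)`. -/
structure IsPreimageMap (lam b c xs : ℝ) (ξ : ℝ → ℝ) : Prop where
  mono : Monotone ξ
  sub_le : ∀ x y, x ≤ y → ξ y - ξ x ≤ y - x
  fixed : ξ xs = xs
  eq : ∀ x, backPhi b c (ξ x) = x + lam * ξ (ξ x)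
  unique : ∀ x u, IsBackward lam b c x u → u 1 = ξ x

theorem exists_isPreimageMap {lam b c xs : ℝ} (h0 : 0 < lam) (hb : 1 + lam < b) (hc : 0 ≤ c)
    (hxs : backPhi b c xs = (1 + lam) * xs) : ∃ ξ, IsPreimageMap lam b c xs ξ := by
  choose U hU using exists_isBackward (c := c) h0 hb hc
  have huniq : ∀ x u, IsBackward lam b c x u → u 1 = U x 1 := fun x u hu => by
    rw [hu.unique h0 hb hc (hU x)]
  refine ⟨fun x => U x 1, fun x y h => ((hU x).compare h0 hb hc (hU y) h 1).1,
    fun x y h => ((hU x).compare h0 hb hc (hU y) h 1).2, ?_, fun x => ?_, huniq⟩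
  · exact (huniq xs (fun _ => xs) ⟨rfl, ⟨|xs|, fun _ => le_rfl⟩, fun _ => by rw [hxs]; ring⟩).symm
  · have h := (hU x).2.2 0
    rw [(hU x).1] at h
    simp only [zero_add] at h
    rw [h, ← huniq _ _ (hU x).shift]

namespace IsPreimageMap

variable {lam b c xs : ℝ} {ξ : ℝ → ℝ}

theorem continuous (h : IsPreimageMap lam b c xs ξ) : Continuous ξ := by
  refine (LipschitzWith.of_dist_le_mul (K := 1) fun x y => ?_).continuous
  rw [NNReal.coe_one, one_mul, Real.dist_eq, Real.dist_eq]
  rcases le_total x y with hxy | hxy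
  · have h1 := h.sub_le x y hxy
    have h2 := h.mono hxy
    rw [abs_of_nonpos (by linarith), abs_of_nonpos (by linarith)]; linarith
  · have h1 := h.sub_le y x hxy
    have h2 := h.mono hxy
    rw [abs_of_nonneg (by linarith), abs_of_nonneg (by linarith)]; linarith

theorem le_self (h : IsPreimageMap lam b c xs ξ) {x : ℝ} (hx : xs ≤ x) : ξ x ≤ x := by
  have := h.sub_le xs x hx
  rw [h.fixed] at this; linarith

theorem ge_fixed (h : IsPreimageMap lam b c xs ξ) {x : ℝ} (hx : xs ≤ x) : xs ≤ ξ x := by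
  have := h.mono hx
  rwa [h.fixed] at this

theorem iterate_mem (h : IsPreimageMap lam b c xs ξ) (hxs : xs < 0) (n : ℕ) :
    xs ≤ ξ^[n] 0 ∧ ξ^[n] 0 ≤ 0 := by
  induction n with
  | zero => exact ⟨hxs.le, le_rfl⟩
  | succ n ih =>
    rw [Function.iterate_succ_apply']
    exact ⟨h.ge_fixed ih.1, (h.le_self ih.1).trans ih.2⟩

/-- The iterates decrease to a fixed point of `ξ`, that is, a root of `backPhi b c L = (1 + lam) *
L`; it is unique since `b > 1 + λ`. -/
theorem tendsto_iterate (h : IsPreimageMap lam b c xs ξ) (hb : 1 + lam < b) (hc : 0 ≤ c)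
    (hxs : xs < 0) (hfix : backPhi b c xs = (1 + lam) * xs) :
    Tendsto (fun n => ξ^[n] 0) atTop (𝓝 xs) := by
  have hanti : Antitone fun n => ξ^[n] 0 := antitone_nat_of_succ_le fun n => by
    rw [Function.iterate_succ_apply']
    exact h.le_self (h.iterate_mem hxs n).1
  have hlim := tendsto_atTop_ciInf hanti
    ⟨xs, by rintro _ ⟨n, rfl⟩; exact (h.iterate_mem hxs n).1⟩
  set L := ⨅ n, ξ^[n] 0
  have hL1 : xs ≤ L := ge_of_tendsto' hlim fun n => (h.iterate_mem hxs n).1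
  have hL2 : L ≤ 0 := le_of_tendsto' hlim fun n => (h.iterate_mem hxs n).2
  have hfixL : ξ L = L := by
    have h1 := (h.continuous.tendsto L).comp hlim
    have h2 := (tendsto_add_atTop_iff_nat 1).2 hlim
    refine tendsto_nhds_unique h1 (h2.congr fun n => ?_)
    rw [Function.iterate_succ_apply']; rfl
  have hL := h.eq L
  rw [hfixL, hfixL] at hL
  have := backPhi_sub_ge (b := b) hc hL1
  have hLe : L = xs := by
    by_contra hne
    have : xs < L := lt_of_le_of_ne hL1 (Ne.symm hne)
    nlinarith
  rwa [hLe] at hlim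

/-- One step of the separatrix has a horizontal extent of at most `1 / (1 - λ)`. -/
theorem sub_le_inv (h : IsPreimageMap lam b c xs ξ) (h0 : 0 < lam) (h1 : lam < 1)
    (hb : 1 + lam < b) (hc : 0 ≤ c) {x : ℝ} (hx : xs ≤ x) (hx0 : x ≤ 0) :
    x - ξ x ≤ 1 / (1 - lam) := by
  set S := sSup ((fun x => x - ξ x) '' Icc xs 0)
  have hbdd : BddAbove ((fun x => x - ξ x) '' Icc xs 0) := by
    refine ⟨-xs, ?_⟩
    rintro _ ⟨y, hy, rfl⟩
    have := h.ge_fixed hy.1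
    simp only; linarith [hy.2]
  have hmem : ∀ y ∈ Icc xs 0, y - ξ y ≤ S := fun y hy => le_csSup hbdd ⟨y, hy, rfl⟩
  -- With `s = ξ y ≤ 0`, the step `y - s` equals `backPhi b c s - (1 + λ) s + λ (s - ξ s)`, and
  -- `backPhi b c s ≤ 1 + b s ≤ 1 + (1 + λ) s`.
  have hS : S ≤ 1 + lam * S := by
    refine csSup_le ⟨_, x, ⟨hx, hx0⟩, rfl⟩ ?_
    rintro _ ⟨y, hy, rfl⟩
    have h2 := h.ge_fixed hy.1
    have h3 : ξ y ≤ 0 := (h.le_self hy.1).trans hy.2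
    have h4 := mul_le_mul_of_nonneg_left (hmem (ξ y) ⟨h2, h3⟩) h0.le
    have h5 := h.eq y
    have h6 := backPhi_sub_ge (b := b) hc h3
    have h7 : backPhi b c 0 = 1 := by simp [backPhi]
    simp only
    nlinarith
  rw [le_div_iff₀ (by linarith)]
  nlinarith [hmem x ⟨hx, hx0⟩]

end IsPreimageMap

/-! ### The crossing point -/

theorem pieceMap_eq_iff {lam b c : ℝ} {p q : ℝ × ℝ} (hp : p.1 ≤ 0) :
    pieceMap lam b c p = q ↔ q.2 = lam * (q.1 - p.1) ∧ backPhi b c p.1 + p.2 = q.1 + lam * p.1 := by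
  rw [Prod.ext_iff]
  simp only [pieceMap, pieceG, backPhi, abs_of_nonpos hp]
  constructor
  · rintro ⟨h1, h2⟩
    constructor
    · rw [← h1, ← h2]; ring
    · rw [← h1]; ring
  · rintro ⟨h1, h2⟩
    have : q.1 = p.1 + p.2 + (1 - b * -p.1 - (1 + lam) * p.1 - c * p.1 ^ 2) := by linarith
    refine ⟨this.symm, ?_⟩
    rw [h1, this]; ring

/-- Uniqueness of bounded solutions forces `ξ 0` as the abscissa of the preimage of the crossing
point; conversely the iterates of `ξ` at `0` form the required orbit. -/
theorem crossing_iff {lam b c xs y : ℝ} {ξ : ℝ → ℝ} (hb : 1 + lam < b) (hc : 0 ≤ c)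
    (hxs : xs < 0) (hfix : backPhi b c xs = (1 + lam) * xs) (h : IsPreimageMap lam b c xs ξ) :
    (∃ q : ℕ → ℝ × ℝ, q 0 = (0, y) ∧ (∀ n, pieceMap lam b c (q (n + 1)) = q n) ∧
      (∀ n, (q n).1 ≤ 0) ∧ Tendsto q atTop (𝓝 (xs, 0))) ↔ y = -lam * ξ 0 := by
  constructor
  · rintro ⟨q, hq0, hq, hneg, hlim⟩
    have hrec := fun n => (pieceMap_eq_iff (hneg (n + 1))).1 (hq n)
    have hback : IsBackward lam b c 0 (fun n => (q n).1) := by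
      refine ⟨by simp [hq0], ?_, fun n => ?_⟩
      · have hl : Tendsto (fun n => (q n).1) atTop (𝓝 xs) :=
          (continuous_fst.tendsto (xs, (0 : ℝ))).comp hlim
        obtain ⟨B, hB⟩ := hl.abs.bddAbove_range
        exact ⟨B, fun n => hB ⟨n, rfl⟩⟩
      · have := (hrec n).2
        rw [(hrec (n + 1)).1] at this
        simp only
        linarith
    have h1 := h.unique 0 _ hback
    have h2 := (hrec 0).1
    simp only [hq0, zero_add] at h1 h2
    rw [h2, h1]; ring
  · rintro rfl
    have hl := h.tendsto_iterate hb hc hxs hfix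
    refine ⟨fun n => (ξ^[n] 0, lam * (ξ^[n] 0 - ξ^[n + 1] 0)), ?_, fun n => ?_,
      fun n => (h.iterate_mem hxs n).2, ?_⟩
    · simp
    · rw [pieceMap_eq_iff (h.iterate_mem hxs (n + 1)).2]
      refine ⟨rfl, ?_⟩
      have := h.eq (ξ^[n] 0)
      rw [← Function.iterate_succ_apply' ξ, ← Function.iterate_succ_apply' ξ] at this
      simp only
      rw [this]; ring
    · have := hl.prodMk_nhds ((hl.sub ((tendsto_add_atTop_iff_nat 1).2 hl)).const_mul lam)
      simpa using this

/-! ### The trapping domain -/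

/-- The domain below the graph of `x ↦ λ (x - ξ (min x 0)) + d`, to the left of `x = m`, above the
line of slope `2 λ` through `(m, λ m)`, and on the right of a line of slope `-(b - 2 λ)` that passes
at a small distance from the saddle. -/
def trap (lam b xs d m η : ℝ) (ξ : ℝ → ℝ) : Set (ℝ × ℝ) :=
  {p | p.2 < lam * (p.1 - ξ (min p.1 0)) + d ∧ p.1 < m ∧ -lam * m < p.2 - 2 * lam * p.1 ∧
    η < p.2 + (b - 2 * lam) * (p.1 - xs)}

/-- The closed version of `trap`. -/
def closedTrap (lam b xs d m η : ℝ) (ξ : ℝ → ℝ) : Set (ℝ × ℝ) :=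
  {p | p.2 ≤ lam * (p.1 - ξ (min p.1 0)) + d ∧ p.1 ≤ m ∧ -lam * m ≤ p.2 - 2 * lam * p.1 ∧
    η ≤ p.2 + (b - 2 * lam) * (p.1 - xs)}

namespace IsPreimageMap

variable {lam b c xs d m η : ℝ} {ξ : ℝ → ℝ}

theorem isOpen_trap (h : IsPreimageMap lam b c xs ξ) : IsOpen (trap lam b xs d m η ξ) := by
  have := h.continuous
  refine IsOpen.and (isOpen_lt ?_ ?_) (IsOpen.and (isOpen_lt ?_ ?_)
    (IsOpen.and (isOpen_lt ?_ ?_) (isOpen_lt ?_ ?_))) <;> fun_prop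

theorem closure_trap_subset (h : IsPreimageMap lam b c xs ξ) :
    closure (trap lam b xs d m η ξ) ⊆ closedTrap lam b xs d m η ξ := by
  have := h.continuous
  refine closure_minimal (fun p hp => ⟨hp.1.le, hp.2.1.le, hp.2.2.1.le, hp.2.2.2.le⟩) ?_
  rw [closedTrap, ofPred_and, ofPred_and, ofPred_and]
  refine IsClosed.inter (isClosed_le ?_ ?_) (IsClosed.inter (isClosed_le ?_ ?_)
    (IsClosed.inter (isClosed_le ?_ ?_) (isClosed_le ?_ ?_))) <;> fun_prop

theorem xs_lt_of_mem (h : IsPreimageMap lam b c xs ξ) (h0 : 0 < lam) (h1 : lam < 1)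
    (hb : 1 + lam < b) (hxs : xs < 0) (hdη : d < η) {p : ℝ × ℝ}
    (hp : p ∈ closedTrap lam b xs d m η ξ) : xs < p.1 := by
  by_contra! hle
  obtain ⟨a1, -, -, a4⟩ := hp
  rw [min_eq_left (hle.trans hxs.le)] at a1
  have h2 := h.sub_le p.1 xs hle
  rw [h.fixed] at h2
  nlinarith

/-- The part of the domain in `x ≤ 0` is mapped strictly inside. -/
theorem map_mem_trap_of_nonpos (h : IsPreimageMap lam b c xs ξ) (h0 : 0 < lam) (h1 : lam < 1)
    (hb : 1 + lam < b) (hc : 0 ≤ c) (hxs : xs < 0) (hfix : backPhi b c xs = (1 + lam) * xs)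
    (hd : 0 < d) (hdη : d < η) (hm : m = 1 - lam * ξ 0 + 2 * d) {p : ℝ × ℝ}
    (hp : p ∈ closedTrap lam b xs d m η ξ) (hp0 : p.1 ≤ 0) :
    pieceMap lam b c p ∈ trap lam b xs d m η ξ := by
  have hxp := h.xs_lt_of_mem h0 h1 hb hxs hdη hp
  obtain ⟨a1, a2, a3, a4⟩ := hp
  rw [min_eq_left hp0] at a1
  obtain ⟨hY, hX⟩ := (pieceMap_eq_iff (lam := lam) (b := b) (c := c) hp0).1 rfl
  set q := pieceMap lam b c p
  have hq : q.1 ≤ d + (backPhi b c p.1 - lam * ξ p.1) := by linarith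
  have hlow : ∀ x y, x ≤ y →
      (b - lam) * (y - x) ≤ backPhi b c y - lam * ξ y - (backPhi b c x - lam * ξ x) := by
    intro x y hxy
    have e1 := backPhi_sub_ge (b := b) hc hxy
    have e2 := mul_le_mul_of_nonneg_left (h.sub_le x y hxy) h0.le
    linarith
  have hqm : q.1 < m := by
    have e1 := hlow p.1 0 hp0
    have e2 : backPhi b c 0 = 1 := by simp [backPhi]
    nlinarith
  refine ⟨?_, hqm, ?_, ?_⟩
  · rw [hY]
    -- The allowed height `d` above the separatrix is multiplied by at most `λ / (b - λ) < 1`.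
    suffices hs : lam * (ξ (min q.1 0) - p.1) < d by linarith
    rcases le_or_gt (ξ (min q.1 0)) p.1 with hle | hlt
    · nlinarith
    · have e1 := hlow p.1 _ hlt.le
      have e2 := h.eq (min q.1 0)
      have e3 := min_le_left q.1 0
      have e4 : (b - lam) * (ξ (min q.1 0) - p.1) ≤ d := by linarith
      nlinarith
  · rw [hY]; nlinarith
  · have e1 := backPhi_sub_ge (b := b) hc hxp.le
    rw [hfix] at e1
    -- The functional defining the left side is expanded by `b - λ > 1`, so points move away from
    -- that side.
    have e5 : (b - lam) * (p.2 + (b - 2 * lam) * (p.1 - xs)) ≤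
        q.2 + (b - 2 * lam) * (q.1 - xs) := by
      have e6 : q.1 = backPhi b c p.1 + p.2 - lam * p.1 := by linarith
      rw [hY, e6]
      have e7 : (b - lam) * (b * (p.1 - xs)) ≤
          (b - lam) * (backPhi b c p.1 - (1 + lam) * xs) :=
        mul_le_mul_of_nonneg_left e1 (by linarith)
      have e8 : 0 ≤ lam * (b - lam - 1) * (p.1 - xs) :=
        mul_nonneg (mul_nonneg h0.le (by linarith)) (by linarith)
      linarith
    nlinarith

/-- The part of the domain in `x ≥ 0` is mapped strictly inside. -/
theorem map_mem_trap_of_nonneg (h : IsPreimageMap lam b c xs ξ) (h0 : 0 < lam) (h1 : lam < 1)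
    (hb : 1 + lam < b) (hc : 0 ≤ c) (hxs : xs < 0)
    (hd : 0 < d) (hm : m = 1 - lam * ξ 0 + 2 * d)
    (hη : η < (pieceMap lam b c (m, lam * m)).2 +
      (b - 2 * lam) * ((pieceMap lam b c (m, lam * m)).1 - xs)) {p : ℝ × ℝ}
    (hp : p ∈ closedTrap lam b xs d m η ξ) (hp0 : 0 ≤ p.1) :
    pieceMap lam b c p ∈ trap lam b xs d m η ξ := by
  obtain ⟨a1, a2, a3, -⟩ := hp
  rw [min_eq_right hp0] at a1
  have hξ0 := h.le_self hxs.le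
  have hY : (pieceMap lam b c p).2 = lam * ((pieceMap lam b c p).1 - p.1) := by
    simp only [pieceMap]; ring
  have hX : (pieceMap lam b c p).1 = 1 + p.2 - (b + lam) * p.1 - c * p.1 ^ 2 := by
    simp only [pieceMap, pieceG, abs_of_nonneg hp0]; ring
  have hsq : 0 ≤ c * p.1 ^ 2 := by positivity
  have hXb : (pieceMap lam b c p).1 ≤ 1 - lam * ξ 0 + d - b * p.1 := by rw [hX]; linarith
  have hbp : p.1 ≤ b * p.1 := by nlinarith
  refine ⟨?_, by linarith, ?_, ?_⟩
  · rw [hY]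
    have e1 : ξ (min (pieceMap lam b c p).1 0) ≤ 0 := (h.mono (min_le_right _ _)).trans hξ0
    nlinarith
  · rw [hY]; nlinarith
  -- At the image point this functional increases with `p.2` and, along the lower edge, decreases
  -- with `p.1`; its minimum is at the corner `(m, λ m)`.
  · refine hη.trans_le ?_
    have hm0 : 0 ≤ m := hp0.trans a2
    have e2 : c * p.1 ^ 2 ≤ c * m ^ 2 :=
      mul_le_mul_of_nonneg_left (pow_le_pow_left₀ hp0 a2 2) hc
    rw [hY, hX]
    simp only [pieceMap, pieceG, abs_of_nonneg hm0]
    have e3 : (b - lam) * (c * p.1 ^ 2) ≤ (b - lam) * (c * m ^ 2) :=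
      mul_le_mul_of_nonneg_left e2 (by linarith)
    have e4 : (b - lam) * (2 * lam * p.1 - lam * m) ≤ (b - lam) * p.2 :=
      mul_le_mul_of_nonneg_left (by linarith) (by linarith)
    have e5 : 0 ≤ ((b - lam) * (b + 1 - lam) - (b - 2 * lam)) * (m - p.1) :=
      mul_nonneg (by nlinarith) (by linarith)
    linarith

theorem isBounded_trap (h : IsPreimageMap lam b c xs ξ) (h0 : 0 < lam) (h1 : lam < 1)
    (hb : 1 + lam < b) (hxs : xs < 0) (hdη : d < η) :
    Bornology.IsBounded (trap lam b xs d m η ξ) := by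
  refine (Metric.isBounded_Icc ((xs, 2 * lam * xs - lam * m) : ℝ × ℝ)
    (m, lam * (m - xs) + d)).subset fun p hp => ?_
  have hxp := h.xs_lt_of_mem h0 h1 hb hxs hdη
    (show p ∈ closedTrap lam b xs d m η ξ from ⟨hp.1.le, hp.2.1.le, hp.2.2.1.le, hp.2.2.2.le⟩)
  obtain ⟨a1, a2, a3, -⟩ := hp
  have := h.ge_fixed (le_min hxp.le hxs.le)
  exact ⟨⟨hxp.le, by simp only; nlinarith⟩, ⟨a2.le, by simp only; nlinarith⟩⟩

theorem isConnected_trap (h : IsPreimageMap lam b c xs ξ) (h0 : 0 < lam) (h1 : lam < 1)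
    (hb : 1 + lam < b) (hxs : xs < 0) (hd : 0 < d) (hm : m = 1 - lam * ξ 0 + 2 * d)
    (hη : η < -(b - 2 * lam) * xs) : IsConnected (trap lam b xs d m η ξ) := by
  have hcont := h.continuous
  have hξ0 := h.le_self hxs.le
  have hm0 : 0 < m := by nlinarith
  constructor
  · refine ⟨(0, 0), ?_, hm0, ?_, ?_⟩
    · simp only [min_self]; nlinarith
    · simp only; nlinarith
    · simp only; linarith
  · set lo : ℝ → ℝ := fun x => max (2 * lam * x - lam * m) (η - (b - 2 * lam) * (x - xs))
    set hi : ℝ → ℝ := fun x => lam * (x - ξ (min x 0)) + d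
    have hlo : Continuous lo := by fun_prop
    have hhi : Continuous hi := by fun_prop
    have hmono : ∀ x y, x ≤ y → hi x ≤ hi y ∧ hi y - hi x ≤ lam * (y - x) := by
      intro x y hxy
      have e0 : min x 0 ≤ min y 0 := min_le_min_right _ hxy
      have e1 := h.sub_le _ _ e0
      have e2 := h.mono e0
      have e3 : min y 0 - min x 0 ≤ y - x := by
        rcases le_total x 0 with hx | hx
        · rw [min_eq_left hx]; linarith [min_le_left y 0]
        · rw [min_eq_right hx]; linarith [min_le_right y 0]
      constructor
      · simp only [hi]; nlinarith
      · simp only [hi]; nlinarith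
    -- The upper boundary has slopes in `[0, λ]`: staying above the line of slope `2λ` persists to
    -- the left, staying above the line of slope `-(b - 2λ)` persists to the right.
    have hI : OrdConnected {x | x < m ∧ lo x < hi x} := by
      refine ⟨fun x hx y hy z hz => ⟨hz.2.trans_lt hy.1, max_lt ?_ ?_⟩⟩
      · have e1 := (max_lt_iff.1 hy.2).1
        have e2 := (hmono z y hz.2).2
        nlinarith [hz.2]
      · have e1 := (max_lt_iff.1 hx.2).2
        have e2 := (hmono x z hz.1).1
        nlinarith [hz.1]
    have himg : trap lam b xs d m η ξ =
        (fun q : ℝ × ℝ => (q.1, lo q.1 + q.2 * (hi q.1 - lo q.1))) ''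
          ({x | x < m ∧ lo x < hi x} ×ˢ Ioo 0 1) := by
      ext p
      constructor
      · rintro ⟨a1, a2, a3, a4⟩
        have e1 : lo p.1 < p.2 := max_lt (by linarith) (by linarith)
        have e2 : p.2 < hi p.1 := a1
        have e3 : 0 < hi p.1 - lo p.1 := by linarith
        refine ⟨(p.1, (p.2 - lo p.1) / (hi p.1 - lo p.1)), ⟨⟨a2, e1.trans e2⟩, ?_, ?_⟩, ?_⟩
        · exact div_pos (by linarith) e3
        · simp only; rw [div_lt_one e3]; linarith
        · refine Prod.ext rfl ?_
          simp only
          rw [div_mul_cancel₀ _ e3.ne']; ring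
      · rintro ⟨⟨x, s⟩, ⟨⟨hx1, hx2⟩, hs0, hs1⟩, rfl⟩
        simp only at hx1 hx2 hs0 hs1
        have e1 : lo x < lo x + s * (hi x - lo x) := by nlinarith
        have e2 : lo x + s * (hi x - lo x) < hi x := by nlinarith
        have e3 := max_lt_iff.1 e1
        refine ⟨e2, hx1, ?_, ?_⟩
        · simp only; linarith [e3.1]
        · simp only; linarith [e3.2]
    rw [himg]
    refine (hI.isPreconnected.prod isPreconnected_Ioo).image _ (Continuous.continuousOn ?_)
    fun_prop

/-- The trapping inequality yields a strange hyperbolic attractor. -/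
theorem hasStrangeHyperbolicAttractor (h : IsPreimageMap lam b c xs ξ) (h0 : 0 < lam)
    (h1 : lam < 1) (hb : 1 + lam < b) (hc : 0 ≤ c) (hxs : xs < 0)
    (hfix : backPhi b c xs = (1 + lam) * xs)
    (htrap : -((pieceMap lam b c)^[2] (0, -lam * ξ 0)).2 ≤
      (1 - lam) * (((pieceMap lam b c)^[2] (0, -lam * ξ 0)).1 - xs)) :
    HasStrangeHyperbolicAttractor (pieceMap lam b c) singularLine := by
  have hξ0 := h.le_self hxs.le
  set x₂ := 1 - lam * ξ 0 with hx₂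
  have hx₂1 : 1 ≤ x₂ := by nlinarith
  have hit : (pieceMap lam b c)^[2] (0, -lam * ξ 0) = pieceMap lam b c (x₂, lam * x₂) := by
    simp only [Function.iterate_succ, Function.iterate_zero, Function.comp_apply, id]
    congr 1
    ext <;> simp only [pieceMap, pieceG, abs_zero, hx₂] <;> ring
  rw [hit] at htrap
  set M := pieceMap lam b c (x₂, lam * x₂) with hM
  have hM1 : M.1 = 1 - b * x₂ - c * x₂ ^ 2 := by
    simp only [hM, pieceMap, pieceG, abs_of_nonneg (zero_le_one.trans hx₂1)]; ring
  have hM2 : M.2 = lam * (M.1 - x₂) := by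
    simp only [hM, pieceMap]; ring
  have hM0 : M.1 < 0 := by
    have : 0 ≤ c * x₂ ^ 2 := by positivity
    nlinarith
  have hMxs : xs < M.1 := by
    by_contra! hle
    nlinarith
  -- Since `b - 2λ > 1 - λ` and `xs < M.1`, the non-strict trapping inequality becomes strict. This
  -- leaves room for `η`, and by continuity for `d`; the second bound on `η` puts the origin in the
  -- domain.
  have hpos : 0 < M.2 + (b - 2 * lam) * (M.1 - xs) := by nlinarith
  obtain ⟨η, hη0, hη⟩ := exists_between (lt_min hpos (by nlinarith : 0 < -(b - 2 * lam) * xs))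
  obtain ⟨hη1, hη2⟩ := lt_min_iff.1 hη
  obtain ⟨d, hd0, hdη, hd⟩ : ∃ d, 0 < d ∧ d < η ∧
      η < (pieceMap lam b c (x₂ + 2 * d, lam * (x₂ + 2 * d))).2 + (b - 2 * lam) *
        ((pieceMap lam b c (x₂ + 2 * d, lam * (x₂ + 2 * d))).1 - xs) := by
    have hcont : Continuous fun d : ℝ => (pieceMap lam b c (x₂ + 2 * d, lam * (x₂ + 2 * d))).2 +
        (b - 2 * lam) * ((pieceMap lam b c (x₂ + 2 * d, lam * (x₂ + 2 * d))).1 - xs) := by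
      have h2 : Continuous fun d : ℝ => pieceMap lam b c (x₂ + 2 * d, lam * (x₂ + 2 * d)) :=
        (continuous_pieceMap lam b c).comp (by fun_prop)
      exact h2.snd.add (continuous_const.mul (h2.fst.sub continuous_const))
    have hev : ∀ᶠ d in 𝓝 (0 : ℝ), η < (pieceMap lam b c (x₂ + 2 * d, lam * (x₂ + 2 * d))).2 +
        (b - 2 * lam) * ((pieceMap lam b c (x₂ + 2 * d, lam * (x₂ + 2 * d))).1 - xs) := by
      refine hcont.continuousAt.eventually_const_lt ?_
      simpa using hη1
    obtain ⟨d, hd3, hd1, hd2⟩ := ((hev.filter_mono nhdsWithin_le_nhds).and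
      (eventually_mem_set.2 (Ioo_mem_nhdsGT hη0))).exists
    exact ⟨d, hd1, hd2, hd3⟩
  set m := x₂ + 2 * d with hm
  have hmaps : ∀ p ∈ closure (trap lam b xs d m η ξ),
      pieceMap lam b c p ∈ trap lam b xs d m η ξ := by
    intro p hp
    have hp' := h.closure_trap_subset hp
    rcases le_total p.1 0 with hp0 | hp0
    · exact h.map_mem_trap_of_nonpos h0 h1 hb hc hxs hfix hd0 hdη hm hp' hp0
    · exact h.map_mem_trap_of_nonneg h0 h1 hb hc hxs hd0 hm hd hp' hp0
  have hbdd := h.isBounded_trap (m := m) h0 h1 hb hxs hdη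
  refine ⟨trap lam b xs d m η ξ, ⟨h.isOpen_trap, h.isConnected_trap h0 h1 hb hxs hd0 hm hη2,
    hbdd, image_subset_iff.2 hmaps⟩, isConeHyperbolicOn_pieceMap h0 h1 hb hc _,
    isSensitiveOn_of_isCompact h0 h1 hb hc hbdd.isCompact_closure fun p hp n => ?_⟩
  obtain ⟨q, hq, rfl⟩ := mem_iInter.1 hp 0
  have hmapsTo : MapsTo (pieceMap lam b c) (trap lam b xs d m η ξ) (trap lam b xs d m η ξ) :=
    fun p hp => hmaps p (subset_closure hp)
  exact subset_closure (hmapsTo.iterate n (hmapsTo hq))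

end IsPreimageMap

/-! ### The saddle and the choice of the parameters -/

theorem saddleX_spec {lam l a : ℝ} (hc : 0 < a * (1 - l)) :
    saddleX lam l a < 0 ∧
      backPhi (a * l) (a * (1 - l)) (saddleX lam l a) = (1 + lam) * saddleX lam l a := by
  set c := a * (1 - l) with hcd
  set δ := a * l - (1 + lam) with hδ
  have hs : √(δ ^ 2 + 4 * a * (1 - l)) ^ 2 = δ ^ 2 + 4 * c := by
    rw [Real.sq_sqrt (by nlinarith [sq_nonneg δ])]; ring
  have e : saddleX lam l a = (δ - √(δ ^ 2 + 4 * a * (1 - l))) / (2 * c) := by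
    rw [saddleX, ← hδ, hcd, hδ]; ring_nf
  set s := √(δ ^ 2 + 4 * a * (1 - l))
  have hs0 : 0 ≤ s := Real.sqrt_nonneg _
  have hneg : saddleX lam l a < 0 := by
    rw [e]
    refine div_neg_of_neg_of_pos ?_ (by positivity)
    nlinarith [abs_le_of_sq_le_sq' (show δ ^ 2 ≤ s ^ 2 by linarith) hs0]
  refine ⟨hneg, ?_⟩
  have hquad : c * saddleX lam l a ^ 2 = 1 + δ * saddleX lam l a := by
    rw [e]; field_simp; nlinarith
  rw [backPhi, abs_of_neg hneg]
  linarith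

/-- As `x₂ ≤ 1 + λ Q = Q`, the inequality reduces to `(b + λ) x₂ + c x₂² - 1 ≤ (1 - λ) (-xs)`, where
the left side is below `4Q + Q² ≤ 5Q²`. -/
theorem trappingInequality_of_large_saddle {lam b c xs Q : ℝ} {ξ : ℝ → ℝ}
    (h : IsPreimageMap lam b c xs ξ) (h0 : 0 < lam) (h1 : lam < 1) (hb : 1 + lam < b)
    (hb3 : b ≤ 3) (hc : 0 ≤ c) (hc1 : c ≤ 1) (hxs : xs < 0) (hQ : Q = 1 / (1 - lam))
    (hlarge : xs ≤ -(5 * Q ^ 3)) :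
    -((pieceMap lam b c)^[2] (0, -lam * ξ 0)).2 ≤
      (1 - lam) * (((pieceMap lam b c)^[2] (0, -lam * ξ 0)).1 - xs) := by
  have hξ0 := h.le_self hxs.le
  have hξ1 := h.sub_le_inv h0 h1 hb hc hxs.le le_rfl
  rw [← hQ] at hξ1
  have hQ1 : (1 - lam) * Q = 1 := by rw [hQ]; field_simp [(sub_pos.2 h1).ne']
  have hQ0 : 1 ≤ Q := by
    rw [hQ, le_div_iff₀ (by linarith)]; linarith
  set x₂ := 1 - lam * ξ 0 with hx₂
  have hx₂1 : 1 ≤ x₂ := by nlinarith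
  have hx₂Q : x₂ ≤ Q := by nlinarith
  have hit : (pieceMap lam b c)^[2] (0, -lam * ξ 0) = pieceMap lam b c (x₂, lam * x₂) := by
    simp only [Function.iterate_succ, Function.iterate_zero, Function.comp_apply, id]
    congr 1
    ext <;> simp only [pieceMap, pieceG, abs_zero, hx₂] <;> ring
  rw [hit]
  simp only [pieceMap, pieceG, abs_of_nonneg (zero_le_one.trans hx₂1)]
  have e1 : 5 * Q ^ 2 ≤ (1 - lam) * (-xs) := by
    calc 5 * Q ^ 2 = ((1 - lam) * Q) * (5 * Q ^ 2) := by rw [hQ1]; ring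
      _ = (1 - lam) * (5 * Q ^ 3) := by ring
      _ ≤ (1 - lam) * (-xs) := mul_le_mul_of_nonneg_left (by linarith) (by linarith)
  have e2 : c * x₂ ^ 2 ≤ 1 * Q ^ 2 :=
    mul_le_mul hc1 (pow_le_pow_left₀ (by linarith) hx₂Q 2) (by positivity) (by norm_num)
  have e3 : (b + lam) * x₂ ≤ 4 * Q := mul_le_mul (by linarith) hx₂Q (by linarith) (by norm_num)
  have e4 : Q ≤ Q ^ 2 := by nlinarith
  linarith

end LoziHenon

theorem theorem4 (lam : ℝ) (hlam0 : 0 < lam) (hlam1 : lam < 1) :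
    ∃ lstar : ℝ, 0 < lstar ∧ lstar < 1 ∧ ∀ l : ℝ, lstar < l → l < 1 →
      (∀ a : ℝ, 1 + lam < a * l →
        (∃! y₁ : ℝ, LoziHenon.IsCrossing lam l a y₁) ∧
        ∀ y₁ : ℝ, LoziHenon.IsCrossing lam l a y₁ →
          LoziHenon.TrappingInequality lam l a y₁ →
          LoziHenon.HasStrangeHyperbolicAttractor (LoziHenon.hybridMap lam l a)
            LoziHenon.singularLine) ∧
      ∃ a y₁ : ℝ, 1 + lam < a * l ∧ LoziHenon.IsCrossing lam l a y₁ ∧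
        LoziHenon.TrappingInequality lam l a y₁ := by
  have h1l : 0 < 1 - lam := by linarith
  obtain ⟨Q, hQ⟩ : ∃ Q, Q = 1 / (1 - lam) := ⟨_, rfl⟩
  have hQ1 : 1 ≤ Q := by rw [hQ, le_div_iff₀ h1l]; linarith
  obtain ⟨X, hX⟩ : ∃ X, X = 5 * Q ^ 3 := ⟨_, rfl⟩
  have hX5 : 5 ≤ X := by
    have := one_le_pow₀ hQ1 (n := 3)
    linarith
  have hXsq : 1 / (12 * X ^ 2) ≤ 1 / 12 := by
    apply one_div_le_one_div_of_le (by norm_num); nlinarith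
  have hXpos : 0 < 1 / (12 * X ^ 2) := by positivity
  -- Beyond `l > 0`, the lower bound on `l` serves only the existence of `a`: with `b / l ≤ 6` it
  -- gives `c ≤ 1 / (2 X²)`.
  refine ⟨1 - 1 / (12 * X ^ 2), by linarith, by linarith, fun l hl hl1 => ?_⟩
  have hl0 : 1 / 2 < l := by linarith
  have setup : ∀ a : ℝ, 1 + lam < a * l → 0 < a * (1 - l) ∧
      ∃ ξ, LoziHenon.IsPreimageMap lam (a * l) (a * (1 - l)) (LoziHenon.saddleX lam l a) ξ ∧
      ∀ y, LoziHenon.IsCrossing lam l a y ↔ y = -lam * ξ 0 := by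
    intro a ha
    have ha0 : 0 < a := by
      by_contra! h
      nlinarith
    have hc : 0 < a * (1 - l) := mul_pos ha0 (by linarith)
    obtain ⟨hneg, hfix⟩ := LoziHenon.saddleX_spec (lam := lam) hc
    obtain ⟨ξ, hξ⟩ := LoziHenon.exists_isPreimageMap hlam0 ha hc.le hfix
    exact ⟨hc, ξ, hξ, fun y => LoziHenon.crossing_iff ha hc.le hneg hfix hξ⟩
  constructor
  · intro a ha
    obtain ⟨hc, ξ, hξ, hcross⟩ := setup a ha
    obtain ⟨hneg, hfix⟩ := LoziHenon.saddleX_spec (lam := lam) hc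
    refine ⟨⟨_, (hcross _).2 rfl, fun y hy => (hcross y).1 hy⟩, fun y hy htrap => ?_⟩
    rw [hcross] at hy
    subst hy
    exact hξ.hasStrangeHyperbolicAttractor hlam0 hlam1 ha hc.le hneg hfix htrap
  · set b := 1 + lam + 1 / (2 * X) with hb
    have hδ : 0 < 1 / (2 * X) := by positivity
    have hδ1 : 1 / (2 * X) ≤ 1 := by rw [div_le_one (by positivity)]; linarith
    have hal : b / l * l = b := div_mul_cancel₀ _ (by linarith)
    have ha : 1 + lam < b / l * l := by rw [hal]; linarith
    obtain ⟨hc, ξ, hξ, hcross⟩ := setup _ ha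
    obtain ⟨hneg, hfix⟩ := LoziHenon.saddleX_spec (lam := lam) hc
    refine ⟨b / l, _, ha, (hcross _).2 rfl, ?_⟩
    rw [LoziHenon.TrappingInequality, LoziHenon.hybridMap_eq_pieceMap]
    have hcX : b / l * (1 - l) ≤ 1 / (2 * X ^ 2) := by
      have e1 : b / l ≤ 6 := by rw [div_le_iff₀ (by linarith)]; linarith
      have e2 : b / l * (1 - l) ≤ 6 * (1 / (12 * X ^ 2)) :=
        mul_le_mul e1 (by linarith) (by linarith) (by norm_num)
      exact e2.trans_eq (by field_simp; norm_num)
    have hc1 : b / l * (1 - l) ≤ 1 := hcX.trans (by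
      rw [div_le_one (by positivity)]; nlinarith)
    refine LoziHenon.trappingInequality_of_large_saddle hξ hlam0 hlam1 ha (by rw [hal]; linarith)
      hc.le hc1 hneg hQ ?_
    rw [← hX]
    by_contra! hlt
    rw [hal] at hfix
    rw [LoziHenon.backPhi, abs_of_neg hneg] at hfix
    set x := LoziHenon.saddleX lam l (b / l)
    set c := b / l * (1 - l)
    -- If `-x < X`, the linear term is below `1/2` and the quadratic one at most `1/2`, so they
    -- cannot sum to `1`.
    have hquad : 1 = 1 / (2 * X) * (-x) + c * (-x) ^ 2 := by
      rw [hb] at hfix; linarith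
    have e1 : 1 / (2 * X) * (-x) < 1 / (2 * X) * X := mul_lt_mul_of_pos_left (by linarith) hδ
    have e2 : c * (-x) ^ 2 ≤ 1 / (2 * X ^ 2) * X ^ 2 :=
      mul_le_mul hcX (pow_le_pow_left₀ (by linarith) (by linarith) 2) (by positivity)
        (by positivity)
    have e3 : 1 / (2 * X) * X = 1 / 2 := by field_simp
    have e4 : 1 / (2 * X ^ 2) * X ^ 2 = 1 / 2 := by field_simp
    linarith
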